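/- Let $d\ge1$ and let $\Gamma$ be the space of locally finite subsets (configurations) $\gamma$ of $\mathbb R^d$, with the vague topology (the weakest topology making $\gamma\mapsto\langle f,\gamma\rangle=\sum_{x\in\gamma}f(x)$ continuous for every continuous compactly supported $f:\mathbb R^d\to\mathbb R$) and its Borel $\sigma$-algebra. Let $\Gamma_0\subset\Gamma$ be the set of finite configurations with the trace $\sigma$-algebra, and let $\lambda=\delta_\varnothing+\sum_{n\ge1}\frac1{n!}dx_1\cdots dx_n$ be the Lebesgue–Poisson measure on $\Gamma_0$. A measurable function $k:\Gamma_0\to[0,\infty)$ is a correlation functional of a probability measure $\mu$ on $\Gamma$ if $\int_\Gamma\sum_{\eta\subset\gamma,\,|\eta|<\infty}H(\eta)\,\mu(d\gamma)=\int_{\Gamma_0}H(\eta)k(\eta)\,\lambda(d\eta)$ for all measurable $H\ge0$ on $\Gamma_0$. Write $k^{(n)}(x_1,\dots,x_n)=k(\{x_1,\dots,x_n\})$; the Ursell functional $u$ of $k$ is defined by $k(\eta)=\sum_\pi\prod_{B\in\pi}u(B)$, the sum being over all partitions $\pi$ of $\eta$. Consider the following conditions on $k$. i) There are $0\le s<1$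 and $C>0$ with $k(\eta)\le(|\eta|!)^sC^{|\eta|}$ for all $\eta\in\Gamma_0$. ii) $k$ is translation invariant: $k(\eta+v)=k(\eta)$ for all $\eta\in\Gamma_0$, $v\in\mathbb R^d$. iii) For all $n,m\ge1$, all $v\in\mathbb R^d\setminus\{0\}$ and all pairwise distinct $x_1,\dots,x_{n+m}\in\mathbb R^d$, $u(\{x_1,\dots,x_n,x_{n+1}+v/\varepsilon,\dots,x_{n+m}+v/\varepsilon\})\to0$ as $\varepsilon\downarrow0$. For functions $\phi^\pm:\mathbb R^d\to\mathbb R$ put $c^-(k)=\int_{\Gamma_0}\prod_{x\in\xi}(e^{-\phi^+(x)}-1)\,k(\xi)\,\lambda(d\xi)$ and $c^+(k)=\int_{\Gamma_0}\prod_{x\in\xi}(e^{\phi^-(x)}-1)\,k(\xi\cup\{0\})\,\lambda(d\xi)$; below (free dynamics) $\phi^+=\phi^-=0$. Let $\Theta$ be the set of $\gamma\in\Gamma$ for which there are $\alpha\ge d$ and $K>0$ with $|\gamma\cap B(n)|\le Kn^\alpha$ for all integers $n\ge1$, where $B(n)$ is the ball of radius $n$ centred at $0$. Let $a\ge0$ be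 an even Schwartz function on $\mathbb R^d$ with $\int a\,dx=1$. The random walk with jump kernel $a(x-y)\,dy$ has the transition probabilities $p_t(x,dy)=e^{-t}\delta_x(dy)+G_t(x-y)\,dy$, where $G_t$ is the inverse Fourier transform of $e^{-t}(\exp[t\,\mathcal Fa]-1)$, $\mathcal Fa(\xi)=\int e^{-2\pi i x\cdot\xi}a(x)\,dx$. For $\gamma\in\Theta$ let $P_t(\gamma,\cdot)$ be the law of the configuration at time $t$ of particles which start at the points of $\gamma$ and move independently, each according to $p_t$. The free Kawasaki dynamics with initial distribution $\mu_0$ is the Markov process on $\Theta$ with transition function $(P_t)_{t\ge0}$ and initial distribution $\mu_0$; its distribution at time $t$ is $\mu_t=\int\mu_0(d\gamma)P_t(\gamma,\cdot)$. Claim. Let $\mu_0$ be a probability measure on $\Gamma$ with $\mu_0(\Theta)=1$ and with a correlation functional $k_0$ satisfying i)–iii). Then for every $t\ge0$, $\mu_t$ is a well-defined probability measure with $\mu_t(\Theta)=1$, it is the one-time marginal at time $t$ of every Markov process as above, and it has a correlation functional $k_t$ which again satisfies i)–iii) and is given, for all $n$ and all pairwise distinct $x_1,\dots,x_n$, by $$k_t^{(n)}(x_1,\dots,x_n)=(p_t^{\otimes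 n}k_0^{(n)})(x_1,\dots,x_n)=\int k_0^{(n)}(y_1,\dots,y_n)\prod_{i=1}^np_t(x_i,dy_i).$$ Moreover $c^-(k_t)=1$ and $c^+(k_t)=k_0^{(1)}$ for all $t\ge0$, where $k_0^{(1)}$ is the constant value of $k_0(\{x\})$, $x\in\mathbb R^d$. -/

import Mathlib

open MeasureTheory Filter Topology
open scoped FourierTransform ENNReal NNReal

namespace FreeKawasaki

noncomputable section

/-- The space `ℝ^d` in which the particles live. -/
abbrev E (d : ℕ) : Type := EuclideanSpace ℝ (Fin d)

/-! ### Configurations -/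

/-- The configuration space `Γ`: locally finite subsets of `ℝ^d`. -/
structure Conf (d : ℕ) where
  carrier : Set (E d)
  locallyFinite : ∀ S : Set (E d), IsCompact S → (carrier ∩ S).Finite

/-- The pairing `⟨f, γ⟩ = ∑_{x ∈ γ} f(x)` (a finite sum when `f` has compact support). -/
def pairing {d : ℕ} (f : E d → ℝ) (γ : Conf d) : ℝ := ∑' x : γ.carrier, f x

/-- The vague topology on `Γ`: the weakest topology making `γ ↦ ⟨f, γ⟩` continuous for every
continuous `f` with compact support. -/
instance instTopologicalSpaceConf (d : ℕ) : TopologicalSpace (Conf d) :=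
  ⨅ f : CompactlySupportedContinuousMap (E d) ℝ,
    TopologicalSpace.induced (pairing (f : E d → ℝ)) inferInstance

/-- The Borel σ-algebra of the vague topology. -/
instance instMeasurableSpaceConf (d : ℕ) : MeasurableSpace (Conf d) := borel (Conf d)

instance instBorelSpaceConf (d : ℕ) : BorelSpace (Conf d) := ⟨rfl⟩

/-- The space `Γ₀` of finite configurations. -/
@[ext]
structure FinConf (d : ℕ) where
  pts : Finset (E d)

/-- The inclusion `Γ₀ ⊆ Γ`. -/
def FinConf.toConf {d : ℕ} (η : FinConf d) : Conf d :=
  ⟨(η.pts : Set (E d)), fun _ _ => η.pts.finite_toSet.inter_of_left _⟩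

/-- `Γ₀` carries the trace of the σ-algebra of `Γ`. -/
instance instMeasurableSpaceFinConf (d : ℕ) : MeasurableSpace (FinConf d) :=
  MeasurableSpace.comap FinConf.toConf inferInstance

open scoped Classical in
/-- The configuration `{x₁, …, xₙ}`. -/
def tupleConf {d n : ℕ} (x : Fin n → E d) : FinConf d := ⟨Finset.univ.image x⟩

/-- The shifted configuration `η_v = {y + v ∣ y ∈ η}`. -/
def FinConf.shift {d : ℕ} (v : E d) (η : FinConf d) : FinConf d :=
  ⟨η.pts.map (addRightEmbedding v)⟩

open scoped Classical in
/-- The union of two finite configurations. -/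
def FinConf.union {d : ℕ} (η ξ : FinConf d) : FinConf d := ⟨η.pts ∪ ξ.pts⟩

/-- The one-point configuration `{x}`. -/
def FinConf.single {d : ℕ} (x : E d) : FinConf d := ⟨{x}⟩

/-! ### Correlation and Ursell functionals -/

/-- The `K`-transform `(K G)(γ) = ∑_{η ⋐ γ} G(η)` of a non-negative function `G` on `Γ₀`. -/
def KTransform {d : ℕ} (G : FinConf d → ℝ≥0∞) (γ : Conf d) : ℝ≥0∞ :=
  ∑' η : {η : FinConf d // (η.pts : Set (E d)) ⊆ γ.carrier}, G η.1

/-- `ρ` is the correlation measure of `μ`. -/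
def IsCorrelationMeasure {d : ℕ} (μ : Measure (Conf d)) (ρ : Measure (FinConf d)) : Prop :=
  ∀ G : FinConf d → ℝ≥0∞, Measurable G → ∫⁻ γ, KTransform G γ ∂μ = ∫⁻ η, G η ∂ρ

/-- The Lebesgue–Poisson measure `λ = ∑_{n ≥ 0} (1/n!) dx₁ ⋯ dxₙ` on `Γ₀`; the measure
`dx₁ ⋯ dxₙ` on `n`-point configurations is the image of Lebesgue measure on the tuples with
pairwise distinct entries, and the term `n = 0` is the unit mass at `∅`. -/
def lebesguePoisson (d : ℕ) : Measure (FinConf d) :=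
  Measure.sum fun n : ℕ =>
    ((n.factorial : ℝ≥0∞)⁻¹) •
      ((Measure.pi fun _ : Fin n => (volume : Measure (E d))).restrict
        {x | Function.Injective x}).map tupleConf

/-- `k` is (a version of) the correlation functional `dρ/dλ` of `μ`, where `ρ` is the correlation
measure of `μ`. -/
structure IsCorrelationFunctional {d : ℕ} (μ : Measure (Conf d)) (k : FinConf d → ℝ) : Prop where
  measurable : Measurable k
  nonneg : ∀ η, 0 ≤ k η
  density : IsCorrelationMeasure μ
    ((lebesguePoisson d).withDensity fun η => ENNReal.ofReal (k η))

open scoped Classical in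
/-- `u` is the Ursell functional of `k`: `k(η) = ∑_π ∏_{B ∈ π} u(B)`, the sum running over all
partitions `π` of `η`. The value of `u` on non-empty configurations is determined by `k`. -/
def IsUrsell {d : ℕ} (k u : FinConf d → ℝ) : Prop :=
  ∀ η : FinConf d, k η = ∑ π : Finpartition η.pts, ∏ B ∈ π.parts, u ⟨B⟩

/-- Condition i): `k(η) ≤ (|η|!)^s C^{|η|}` for some `0 ≤ s < 1` and `C > 0`. -/
def GrowthBound {d : ℕ} (k : FinConf d → ℝ) : Prop :=
  ∃ s C : ℝ, 0 ≤ s ∧ s < 1 ∧ 0 < C ∧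
    ∀ η : FinConf d, k η ≤ (η.pts.card.factorial : ℝ) ^ s * C ^ η.pts.card

/-- Condition ii): translation invariance. -/
def TranslationInvariant {d : ℕ} (k : FinConf d → ℝ) : Prop :=
  ∀ (v : E d) (η : FinConf d), k (η.shift v) = k η

/-- Condition iii): decay of correlations, in terms of the Ursell functional of `k`. -/
def DecayOfCorrelations {d : ℕ} (k : FinConf d → ℝ) : Prop :=
  ∃ u : FinConf d → ℝ, IsUrsell k u ∧
    ∀ η ξ : FinConf d, η.pts.Nonempty → ξ.pts.Nonempty → Disjoint η.pts ξ.pts →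
      ∀ v : E d, v ≠ 0 →
        Tendsto (fun ε : ℝ => u (η.union (ξ.shift (ε⁻¹ • v)))) (𝓝[>] 0) (𝓝 0)

/-- Conditions i)–iii) together. -/
structure IsAdmissible {d : ℕ} (k : FinConf d → ℝ) : Prop where
  growth : GrowthBound k
  translation : TranslationInvariant k
  decay : DecayOfCorrelations k

/-- The correlation functions `k^{(n)}(x₁, …, xₙ) = k({x₁, …, xₙ})`. -/
def corrFun {d : ℕ} (k : FinConf d → ℝ) (n : ℕ) (x : Fin n → E d) : ℝ := k (tupleConf x)

/-- `e_λ(f, η) = ∏_{x ∈ η} f(x)`. -/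
def expLambda {d : ℕ} (f : E d → ℝ) (η : FinConf d) : ℝ := ∏ x ∈ η.pts, f x

/-- `c⁻(k) = ∫ λ(dξ) e_λ(e^{-φ⁺} - 1, ξ) k(ξ)`. -/
def cMinus {d : ℕ} (φplus : E d → ℝ) (k : FinConf d → ℝ) : ℝ :=
  ∫ ξ, expLambda (fun x => Real.exp (-φplus x) - 1) ξ * k ξ ∂(lebesguePoisson d)

/-- `c⁺(k) = ∫ λ(dξ) e_λ(e^{φ⁻} - 1, ξ) k(ξ ∪ {0})`. -/
def cPlus {d : ℕ} (φminus : E d → ℝ) (k : FinConf d → ℝ) : ℝ :=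
  ∫ ξ, expLambda (fun x => Real.exp (φminus x) - 1) ξ * k (ξ.union (FinConf.single 0))
    ∂(lebesguePoisson d)

/-! ### The free dynamics -/

/-- The set `Θ` of configurations with at most polynomial growth. -/
def Theta (d : ℕ) : Set (Conf d) :=
  {γ | ∃ α K : ℝ, (d : ℝ) ≤ α ∧ 0 < K ∧
    ∀ n : ℕ, 1 ≤ n → ((γ.carrier ∩ Metric.closedBall 0 (n : ℝ)).ncard : ℝ) ≤ K * (n : ℝ) ^ α}

/-- The function `G = G_t` of the random walk semigroup: the inverse Fourier transform of
`e^{-t} (exp (t 𝓕a) - 1)`, where `𝓕a(ξ) = ∫ e^{-2πi⟨x,ξ⟩} a(x) dx`. -/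
def walkDensity {d : ℕ} (a : SchwartzMap (E d) ℝ) (t : ℝ≥0) (x : E d) : ℝ :=
  (𝓕⁻ (fun ξ : E d => (Real.exp (-(t : ℝ)) : ℂ) *
    (Complex.exp ((t : ℂ) * 𝓕 (fun y : E d => ((a y : ℝ) : ℂ)) ξ) - 1)) x).re

/-- The transition probability `p_t(x, dy) = e^{-t} δ_x(dy) + G_t(x - y) dy` of the random walk
with jump kernel `a(x - y) dy`. -/
def walkKernel {d : ℕ} (a : SchwartzMap (E d) ℝ) (t : ℝ≥0) (x : E d) : Measure (E d) :=
  ENNReal.ofReal (Real.exp (-(t : ℝ))) • Measure.dirac x +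
    (volume : Measure (E d)).withDensity fun y => ENNReal.ofReal (walkDensity a t (x - y))

/-- The operator `p_t^{⊗n}` on functions of `n` points. -/
def walkTensor {d : ℕ} (a : SchwartzMap (E d) ℝ) (t : ℝ≥0) (n : ℕ)
    (F : (Fin n → E d) → ℝ) (x : Fin n → E d) : ℝ :=
  ∫ y, F y ∂(Measure.pi fun i => walkKernel a t (x i))

open scoped Classical in
/-- A subset of `ℝ^d` regarded as a configuration (and the empty configuration if the set is
not locally finite). -/
def setToConf {d : ℕ} (s : Set (E d)) : Conf d :=
  if h : ∀ S : Set (E d), IsCompact S → (s ∩ S).Finite then ⟨s, h⟩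
  else ⟨∅, fun _ _ => Set.finite_empty.inter_of_left _⟩

/-- The transition function `P_t(γ, ·)` of the free dynamics: the particles `x ∈ γ` move
independently, each one according to `p_t(x, ·)`, and `P_t(γ, ·)` is the law of the configuration
of their positions at time `t`. -/
def freeTransition {d : ℕ} (a : SchwartzMap (E d) ℝ) (t : ℝ≥0) (γ : Conf d) :
    Measure (Conf d) :=
  (Measure.infinitePi fun x : γ.carrier => walkKernel a t (x : E d)).map
    fun w => setToConf (Set.range w)

/-- The distribution `μ_t = ∫ μ₀(dγ) P_t(γ, ·)` at time `t` of the free dynamics with initial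
distribution `μ₀`. -/
def freeLaw {d : ℕ} (a : SchwartzMap (E d) ℝ) (μ₀ : Measure (Conf d)) (t : ℝ≥0) :
    Measure (Conf d) :=
  μ₀.bind (freeTransition a t)

/-- The σ-algebra on path space generated by the configurations up to time `s`. -/
@[reducible]
def past (d : ℕ) (s : ℝ≥0) : MeasurableSpace (ℝ≥0 → Conf d) :=
  ⨆ r : Set.Iic s, MeasurableSpace.comap (fun ω : ℝ≥0 → Conf d => ω r) inferInstance

/-- `ℙ` is the law, on the space of paths, of a Markov process on `Θ` with transition function
`P_t` and initial distribution `μ₀`. -/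
structure IsFreeKawasakiProcess {d : ℕ} (a : SchwartzMap (E d) ℝ) (μ₀ : Measure (Conf d))
    (ℙ : Measure (ℝ≥0 → Conf d)) : Prop where
  isProbabilityMeasure : IsProbabilityMeasure ℙ
  initial : ℙ.map (fun ω => ω 0) = μ₀
  mem_Theta : ∀ t : ℝ≥0, ∀ᵐ ω ∂ℙ, ω t ∈ Theta d
  markov : ∀ (s t : ℝ≥0) (A : Set (Conf d)), MeasurableSet A →
    condExp (past d s) ℙ (Set.indicator {ω | ω (s + t) ∈ A} fun _ => (1 : ℝ))
      =ᵐ[ℙ] fun ω => (freeTransition a t (ω s)).real A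

end

end FreeKawasaki

/-! At time t the particles have been displaced by independent vectors with the common law ν =
`walkKernel a t 0`, so the claim concerns independent displacements of a point process. Three facts
about ν suffice. It is a probability measure and it is symmetric, both by expanding G_t as an
exponential series in the convolution powers of a (`hasSum_walkDensity`). It has no atom outside 0,
so particles with different starting points almost surely do not collide (`ae_add_ne`).

Well-definedness: the intensity is constant, so Campbell's formula shows that for almost every
initial configuration the expected number of displaced particles in each ball is finite
(`ae_dispersed`). Measurability is tested on void events, which generate the Borel σ-algebra
(`generateFrom_voidSet`) and whose probabilities are infima of finite products
(`Dispersed.displacedLaw_voidSet`).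

Correlation functional: without collisions, the finite subsets of the displaced configuration are
the displacements of the finite subsets of the initial one, so displacement commutes with the
`K`-transform (`Dispersed.lintegral_KTransform`). Symmetry of ν and translation invariance of
Lebesgue measure then move the displacement from the observable onto k₀ (`lintegral_levolved_mul`).
Hence `evolved ν k₀` is a correlation functional at time t, and on tuples of distinct points it is
the stated tensor power (`walkTensor_corrFun`).

Conditions i) and ii) pass through the expectation. For iii), displacements of disjoint blocks are
independent, so the Ursell functional of `evolved ν k` is `evolved ν u` (`isUrsell_evolved`), and
dominated convergence preserves the decay. Bounded intensity gives polynomial growth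
(`measure_Theta`). The free functionals only see the empty configuration
(`integral_expLambda_zero`), which leaves k(∅) = 1 and the conserved density. -/

namespace FreeKawasaki

noncomputable section

/-! ### The vague topology is second countable -/

lemma Conf.countable {d : ℕ} (γ : Conf d) : γ.carrier.Countable := by
  have h : γ.carrier = ⋃ n : ℕ, γ.carrier ∩ Metric.closedBall 0 n := by
    rw [← Set.inter_iUnion, Metric.iUnion_closedBall_nat, Set.inter_univ]
  rw [h]
  exact Set.countable_iUnion fun n => (γ.locallyFinite _ (isCompact_closedBall _ _)).countable

lemma pairing_eq_sum {d : ℕ} (γ : Conf d) {f : E d → ℝ} {S : Set (E d)} (hS : IsCompact S)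
    (hf : ∀ x, x ∉ S → f x = 0) :
    pairing f γ = ∑ x ∈ (γ.locallyFinite S hS).toFinset, f x := by
  unfold pairing
  rw [tsum_subtype γ.carrier f, tsum_eq_sum (s := (γ.locallyFinite S hS).toFinset)]
  · refine Finset.sum_congr rfl fun x hx => ?_
    rw [Set.Finite.mem_toFinset] at hx
    exact Set.indicator_of_mem hx.1 f
  · intro x hx
    rw [Set.Finite.mem_toFinset] at hx
    by_cases h : x ∈ γ.carrier
    · rw [Set.indicator_of_mem h]
      exact hf x fun hxS => hx ⟨h, hxS⟩
    · exact Set.indicator_of_notMem h f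

lemma continuous_pairing {d : ℕ} (f : CompactlySupportedContinuousMap (E d) ℝ) :
    Continuous (pairing (d := d) f) :=
  continuous_iInf_dom (i := f) continuous_induced_dom

/-- Continuous functions vanishing off the closed ball of radius `n`. -/
abbrev SupportedIn (d n : ℕ) : Type :=
  {f : C(E d, ℝ) // ∀ x, x ∉ Metric.closedBall (0 : E d) n → f x = 0}

instance (d n : ℕ) : Nonempty (SupportedIn d n) := ⟨⟨0, fun _ _ => rfl⟩⟩

instance (d n : ℕ) : TopologicalSpace.SeparableSpace (SupportedIn d n) := by
  have : SecondCountableTopology C(E d, ℝ) := inferInstance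
  have : SecondCountableTopology (SupportedIn d n) :=
    TopologicalSpace.Subtype.secondCountableTopology _
  infer_instance

def SupportedIn.toCc {d n : ℕ} (f : SupportedIn d n) : CompactlySupportedContinuousMap (E d) ℝ :=
  ⟨f.1, HasCompactSupport.intro (isCompact_closedBall 0 n) f.2⟩

/-- Restriction to the ball is continuous from the compact-open topology to the sup norm, so density
gives uniform approximation. Both functions vanish off the ball, which is what the indicator
records. -/
lemma SupportedIn.exists_denseSeq_lt {d n : ℕ} (f : SupportedIn d n) {δ : ℝ} (hδ : 0 < δ) :
    ∃ k, ∀ x, |f.1 x - (TopologicalSpace.denseSeq (SupportedIn d n) k).1 x| ≤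
      δ * (Metric.closedBall (0 : E d) n).indicator 1 x := by
  have : CompactSpace (Metric.closedBall (0 : E d) n) :=
    isCompact_iff_compactSpace.1 (isCompact_closedBall _ _)
  let r : SupportedIn d n → C(Metric.closedBall (0 : E d) n, ℝ) := fun g => g.1.restrict _
  have hr : Continuous r :=
    (ContinuousMap.continuous_restrict _).comp continuous_subtype_val
  obtain ⟨k, hk⟩ := (TopologicalSpace.denseRange_denseSeq (SupportedIn d n)).exists_mem_open
    (Metric.isOpen_ball.preimage hr) ⟨f, Metric.mem_ball_self (x := r f) hδ⟩
  refine ⟨k, fun x => ?_⟩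
  set g := TopologicalSpace.denseSeq (SupportedIn d n) k
  by_cases hx : x ∈ Metric.closedBall (0 : E d) n
  · rw [Set.indicator_of_mem hx, Pi.one_apply, mul_one]
    rw [Set.mem_preimage, Metric.mem_ball, dist_comm] at hk
    have := (ContinuousMap.dist_lt_iff hδ).1 hk ⟨x, hx⟩
    exact this.le
  · rw [Set.indicator_of_notMem hx, f.2 x hx, g.2 x hx]
    simp

/-- A continuous bump equal to one on the closed ball of radius `n`. -/
def bump (d n : ℕ) : SupportedIn d (n + 1) :=
  ⟨⟨fun x => max 0 (min 1 (n + 1 - ‖x‖)), by fun_prop⟩, fun x hx => by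
    rw [mem_closedBall_zero_iff, not_le] at hx
    push_cast at hx
    exact max_eq_left ((min_le_right _ _).trans (by linarith))⟩

lemma indicator_le_bump (d n : ℕ) (x : E d) :
    (Metric.closedBall (0 : E d) n).indicator (1 : E d → ℝ) x ≤ (bump d n).1 x := by
  by_cases hx : x ∈ Metric.closedBall (0 : E d) n
  · rw [Set.indicator_of_mem hx]
    rw [mem_closedBall_zero_iff] at hx
    exact le_max_of_le_right (le_min le_rfl (by rw [Pi.one_apply]; linarith))
  · rw [Set.indicator_of_notMem hx]
    exact le_max_left _ _

lemma exists_supportedIn {d : ℕ} (f : CompactlySupportedContinuousMap (E d) ℝ) :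
    ∃ n : ℕ, ∃ g : SupportedIn d n, g.toCc = f := by
  obtain ⟨r, hr⟩ := f.hasCompactSupport.isCompact.isBounded.subset_closedBall 0
  obtain ⟨n, hn⟩ := exists_nat_ge r
  refine ⟨n, ⟨f.toContinuousMap, fun x hx => ?_⟩, rfl⟩
  by_contra h
  exact hx (Metric.closedBall_subset_closedBall hn (hr (subset_tsupport f h)))

/-- A countable family of test functions that generates the vague topology. -/
def testFun (d : ℕ) : (ℕ × ℕ) ⊕ ℕ → CompactlySupportedContinuousMap (E d) ℝ
  | .inl p => (TopologicalSpace.denseSeq (SupportedIn d p.1) p.2).toCc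
  | .inr n => (bump d n).toCc

/-- A uniform error is multiplied by the number of points in the ball. The bump bounds that number
by a functional that is itself vaguely continuous, hence locally bounded in γ. -/
lemma abs_pairing_sub_le {d n : ℕ} (γ : Conf d) (f g : SupportedIn d n) {δ : ℝ} (hδ : 0 ≤ δ)
    (h : ∀ x, |f.1 x - g.1 x| ≤ δ * (Metric.closedBall (0 : E d) n).indicator 1 x) :
    |pairing f.1 γ - pairing g.1 γ| ≤ δ * pairing (bump d n).1 γ := by
  have hK := isCompact_closedBall (0 : E d) ((n + 1 : ℕ) : ℝ)
  have hsub : ∀ x : E d, x ∉ Metric.closedBall (0 : E d) ((n + 1 : ℕ) : ℝ) →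
      x ∉ Metric.closedBall (0 : E d) (n : ℝ) := fun x hx h =>
    hx (Metric.closedBall_subset_closedBall (by push_cast; linarith) h)
  rw [pairing_eq_sum γ hK fun x hx => f.2 x (hsub x hx),
    pairing_eq_sum γ hK fun x hx => g.2 x (hsub x hx),
    pairing_eq_sum γ hK fun x hx => (bump d n).2 x hx, ← Finset.sum_sub_distrib, Finset.mul_sum]
  refine (Finset.abs_sum_le_sum_abs _ _).trans (Finset.sum_le_sum fun x _ => (h x).trans ?_)
  exact mul_le_mul_of_nonneg_left (indicator_le_bump d n x) hδ

/-- An ε/3 argument: near γ₀ the pairing with a bump stays below a constant, so replacing f by a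
member of the dense sequence changes the pairings uniformly little. -/
lemma vague_eq_induced (d : ℕ) :
    instTopologicalSpaceConf d =
      TopologicalSpace.induced (fun γ i => pairing (testFun d i) γ) inferInstance := by
  have hpi : TopologicalSpace.induced (fun γ i => pairing (testFun d i) γ) inferInstance =
      ⨅ i, TopologicalSpace.induced (pairing (testFun d i)) inferInstance := by
    simp only [Pi.topologicalSpace, induced_iInf, induced_compose, Function.comp_def]
  refine le_antisymm ?_ ?_
  · rw [hpi]
    exact le_iInf fun i => iInf_le _ (testFun d i)
  · refine le_iInf fun f => ?_
    rw [← continuous_iff_le_induced]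
    let _ : TopologicalSpace (Conf d) :=
      TopologicalSpace.induced (fun γ i => pairing (testFun d i) γ) inferInstance
    have hc : ∀ i, Continuous (pairing (d := d) (testFun d i)) := fun i =>
      (continuous_apply i).comp
        (continuous_induced_dom (f := fun (γ : Conf d) i => pairing (testFun d i) γ))
    obtain ⟨n, f, rfl⟩ := exists_supportedIn f
    rw [continuous_iff_continuousAt]
    intro γ₀
    rw [Metric.continuousAt_iff']
    intro ε hε
    set M := pairing (bump d n).1 γ₀ + 1
    have hM : 0 < M := by
      have : 0 ≤ pairing (bump d n).1 γ₀ := tsum_nonneg fun x => le_max_left _ _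
      positivity
    -- The accuracy is chosen so that the error δ · M in the pairing is exactly ε/3.
    obtain ⟨k, hk⟩ := f.exists_denseSeq_lt (δ := ε / (3 * M)) (by positivity)
    set g := TopologicalSpace.denseSeq (SupportedIn d n) k
    have h1 : ∀ᶠ γ in 𝓝 γ₀, pairing (bump d n).1 γ < M :=
      (hc (.inr n)).continuousAt.eventually_lt continuousAt_const (lt_add_one _)
    have h2 := Metric.continuousAt_iff'.1 ((hc (.inl (n, k))).continuousAt (x := γ₀)) (ε / 3)
      (by positivity)
    filter_upwards [h1, h2] with γ h1 h2
    have hb : ∀ γ, pairing (bump d n).1 γ ≤ M →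
        |pairing f.1 γ - pairing g.1 γ| ≤ ε / 3 := fun γ h => by
      refine (abs_pairing_sub_le γ f g (by positivity) hk).trans ?_
      refine (mul_le_mul_of_nonneg_left h (by positivity)).trans (le_of_eq ?_)
      field_simp
    have h3 := hb γ h1.le
    have h4 := hb γ₀ (lt_add_one _).le
    rw [Real.dist_eq] at h2 ⊢
    change |pairing g.1 γ - pairing g.1 γ₀| < ε / 3 at h2
    change |pairing f.1 γ - pairing f.1 γ₀| < ε
    rw [abs_lt] at *
    rw [abs_le] at h3 h4
    constructor <;> linarith [h3.1, h3.2, h4.1, h4.2, h2.1, h2.2]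

/-- Countability of the generating family is essential: it identifies the Borel σ-algebra with the
pullback of the product σ-algebra on a countable power of ℝ. -/
lemma measurable_of_pairing {d : ℕ} {Ω : Type*} [MeasurableSpace Ω] {c : Ω → Conf d}
    (h : ∀ g : CompactlySupportedContinuousMap (E d) ℝ, Measurable fun ω => pairing g (c ω)) :
    Measurable c := by
  have hb : instMeasurableSpaceConf d = MeasurableSpace.comap
      (fun γ i => pairing (testFun d i) γ) inferInstance := by
    change @borel _ (instTopologicalSpaceConf d) = _
    rw [vague_eq_induced, borel_comap, ← BorelSpace.measurable_eq (α := (ℕ × ℕ) ⊕ ℕ → ℝ)]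
  rw [hb, measurable_comap_iff]
  exact measurable_pi_iff.2 fun i => h _

/-! ### The counting measure of a configuration -/

/-- The counting measure of a configuration. -/
def cnt {d : ℕ} (γ : Conf d) : Measure (E d) := Measure.count.restrict γ.carrier

lemma lintegral_cnt {d : ℕ} (γ : Conf d) (f : E d → ℝ≥0∞) :
    ∫⁻ x, f x ∂cnt γ = ∑' x : γ.carrier, f x := by
  rw [cnt, lintegral_countable _ γ.countable]
  simp

lemma cnt_apply {d : ℕ} (γ : Conf d) {B : Set (E d)} (hB : MeasurableSet B) :
    cnt γ B = (B ∩ γ.carrier).encard := by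
  rw [cnt, Measure.restrict_apply hB, Measure.count_apply (hB.inter γ.countable.measurableSet)]

instance {d : ℕ} (γ : Conf d) : IsFiniteMeasureOnCompacts (cnt γ) := ⟨fun K hK => by
  rw [cnt_apply γ hK.measurableSet, Set.inter_comm, ENat.toENNReal_lt_top]
  exact (γ.locallyFinite K hK).encard_lt_top⟩

lemma cnt_apply_of_isCompact {d : ℕ} (γ : Conf d) {K : Set (E d)} (hK : IsCompact K) :
    cnt γ K = ((γ.locallyFinite K hK).toFinset.card : ℝ≥0∞) := by
  rw [cnt_apply γ hK.measurableSet, Set.inter_comm,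
    (γ.locallyFinite K hK).encard_eq_coe_toFinset_card]
  simp

/-- The indicator of K is the pointwise limit of continuous thickened indicators. All of them vanish
outside one compact neighbourhood of K, so for each γ the pairings are sums over one fixed finite
set and converge. -/
lemma measurable_cnt_of_isCompact {d : ℕ} {K : Set (E d)} (hK : IsCompact K) :
    Measurable fun γ : Conf d => cnt γ K := by
  have hpos : ∀ n : ℕ, (0 : ℝ) < 1 / (n + 1) := fun n => by positivity
  let f : ℕ → E d → ℝ := fun n x => (thickenedIndicator (hpos n) K x : ℝ)
  have hs : ∀ n x, x ∉ Metric.cthickening 1 K → f n x = 0 := fun n x hx => by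
    have : x ∉ Metric.thickening (1 / ((n : ℝ) + 1)) K := fun h => hx <|
      Metric.thickening_subset_cthickening_of_le (by
        rw [div_le_one (by positivity)]; linarith [n.cast_nonneg (α := ℝ)]) _ h
    simp only [f, thickenedIndicator_zero (hpos n) K this, NNReal.coe_zero]
  have hK1 : IsCompact (Metric.cthickening 1 K) := hK.cthickening
  let F : ℕ → CompactlySupportedContinuousMap (E d) ℝ := fun n =>
    ⟨⟨f n, NNReal.continuous_coe.comp (thickenedIndicator (hpos n) K).continuous⟩,
      HasCompactSupport.intro hK1 (hs n)⟩
  refine measurable_of_tendsto_metrizable (f := fun n γ => ENNReal.ofReal (pairing (F n) γ))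
    (fun n => (continuous_pairing (F n)).measurable.ennreal_ofReal) ?_
  rw [tendsto_pi_nhds]
  intro γ
  have hind : Tendsto (fun n x => f n x) atTop (𝓝 (K.indicator 1)) := by
    have := thickenedIndicator_tendsto_indicator_closure hpos
      tendsto_one_div_add_atTop_nhds_zero_nat K
    rw [tendsto_pi_nhds] at this ⊢
    intro x
    have := (NNReal.continuous_coe.tendsto _).comp (this x)
    rw [hK.isClosed.closure_eq] at this
    have h1 : K.indicator (1 : E d → ℝ) x = ((K.indicator (fun _ => (1 : ℝ≥0)) x : ℝ≥0) : ℝ) := by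
      by_cases hx : x ∈ K <;> simp [hx]
    rw [h1]
    exact this
  have hsum : ∀ n, pairing (F n) γ = ∑ x ∈ (γ.locallyFinite _ hK1).toFinset, f n x :=
    fun n => pairing_eq_sum γ hK1 (hs n)
  simp_rw [hsum]
  have hlim : cnt γ K = ENNReal.ofReal
      (∑ x ∈ (γ.locallyFinite _ hK1).toFinset, K.indicator (1 : E d → ℝ) x) := by
    rw [cnt_apply_of_isCompact γ hK]
    have : (γ.locallyFinite K hK).toFinset ⊆ (γ.locallyFinite _ hK1).toFinset :=
      Set.Finite.toFinset_subset_toFinset.2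
        (Set.inter_subset_inter_right _ (Metric.self_subset_cthickening K))
    rw [← Finset.sum_subset this]
    · rw [Finset.sum_congr rfl (g := fun _ => (1 : ℝ))]
      · simp
      · intro x hx
        rw [Set.Finite.mem_toFinset] at hx
        exact Set.indicator_of_mem hx.2 _
    · intro x hx hxK
      rw [Set.Finite.mem_toFinset] at hx hxK
      exact Set.indicator_of_notMem (fun h => hxK ⟨hx.1, h⟩) _
  rw [hlim]
  refine (ENNReal.continuous_ofReal.tendsto _).comp ?_
  exact tendsto_finsetSum _ fun x _ => (tendsto_pi_nhds.1 hind) x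

/-- Cutting off to balls makes the counting measures finite, so that the π-system of closed sets
suffices; the cutoff is then removed by monotone convergence. -/
lemma measurable_cnt {d : ℕ} {B : Set (E d)} (hB : MeasurableSet B) :
    Measurable fun γ : Conf d => cnt γ B := by
  have h : ∀ m : ℕ, Measurable fun γ : Conf d =>
      (cnt γ).restrict (Metric.closedBall 0 m) := fun m => by
    have hK := isCompact_closedBall (0 : E d) m
    have (γ : Conf d) : IsFiniteMeasure ((cnt γ).restrict (Metric.closedBall 0 m)) :=
      isFiniteMeasure_restrict.2 hK.measure_lt_top.ne
    refine Measurable.measure_of_isPiSystem (S := {s : Set (E d) | IsClosed s}) ?_ ?_ ?_ ?_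
    · rw [← borel_eq_generateFrom_isClosed]; exact BorelSpace.measurable_eq
    · exact isPiSystem_isClosed
    · intro s hs
      simp_rw [Measure.restrict_apply hs.measurableSet]
      exact measurable_cnt_of_isCompact (hK.inter_left hs)
    · simp_rw [Measure.restrict_apply MeasurableSet.univ, Set.univ_inter]
      exact measurable_cnt_of_isCompact hK
  have heq : ∀ γ : Conf d, cnt γ B = ⨆ m : ℕ, (cnt γ).restrict (Metric.closedBall 0 m) B := by
    intro γ
    have : B = ⋃ m : ℕ, B ∩ Metric.closedBall 0 (m : ℝ) := by
      rw [← Set.inter_iUnion, Metric.iUnion_closedBall_nat, Set.inter_univ]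
    conv_lhs => rw [this]
    rw [Monotone.measure_iUnion]
    · simp_rw [Measure.restrict_apply hB]
    · intro i j hij
      exact Set.inter_subset_inter_right _
        (Metric.closedBall_subset_closedBall (by exact_mod_cast hij))
  simp_rw [heq]
  exact Measurable.iSup fun m => (Measure.measurable_coe hB).comp (h m)

/-! ### Void events generate the σ-algebra -/

open scoped Classical in
-- Finitely many points of B can be separated by disjoint basic open sets, and conversely each
-- member of a disjoint family that is hit contributes at least one point. Thus counts are countable
-- suprema of expressions in void events.
lemma cnt_apply_eq_iSup {d : ℕ} (γ : Conf d) {B : Set (E d)} (hB : MeasurableSet B) :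
    cnt γ B = ⨆ P : {P : Finset (TopologicalSpace.countableBasis (E d)) //
        (P : Set (TopologicalSpace.countableBasis (E d))).PairwiseDisjoint Subtype.val},
      ∑ U ∈ P.1, if Disjoint γ.carrier (B ∩ U.1) then (0 : ℝ≥0∞) else 1 := by
  apply le_antisymm
  · rw [cnt_apply γ hB]
    refine le_of_forall_lt fun c hc => ?_
    obtain ⟨F, hF, hcF⟩ : ∃ F : Finset (E d), (F : Set (E d)) ⊆ B ∩ γ.carrier ∧
        c < (F.card : ℝ≥0∞) := by
      by_cases hfin : (B ∩ γ.carrier).Finite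
      · refine ⟨hfin.toFinset, by simp, ?_⟩
        rw [hfin.encard_eq_coe_toFinset_card] at hc
        simpa using hc
      · obtain ⟨n, hn⟩ := ENNReal.exists_nat_gt hc.ne_top
        obtain ⟨F, hF, hFn⟩ := (Set.not_finite.1 hfin).exists_subset_card_eq n
        exact ⟨F, hF, by rw [hFn]; exact hn⟩
    refine hcF.trans_le ?_
    obtain ⟨U, hU, hd⟩ := F.finite_toSet.t2_separation
    have hV : ∀ x : E d, ∃ V : TopologicalSpace.countableBasis (E d), x ∈ V.1 ∧ V.1 ⊆ U x :=
      fun x => by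
        obtain ⟨V, hV, hxV, hVU⟩ :=
          (TopologicalSpace.isBasis_countableBasis (E d)).exists_subset_of_mem_open
            (hU x).1 (hU x).2
        exact ⟨⟨V, hV⟩, hxV, hVU⟩
    choose V hxV hVU using hV
    have hinj : Set.InjOn V (F : Set (E d)) := fun x hx y hy hxy => by
      by_contra hne
      exact Set.disjoint_left.1 (hd hx hy hne) (hVU x (hxV x)) (hVU y (hxy ▸ hxV x))
    refine le_trans ?_ (le_iSup _ ⟨F.image V, ?_⟩)
    · dsimp only
      rw [Finset.sum_image hinj, Finset.sum_congr rfl (g := fun _ => (1 : ℝ≥0∞))]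
      · simp
      · intro x hx
        rw [if_neg]
        exact fun h => Set.disjoint_left.1 h (hF hx).2 ⟨(hF hx).1, hxV x⟩
    · intro A hA A' hA' hne
      simp only [Finset.coe_image, Set.mem_image] at hA hA'
      obtain ⟨x, hx, rfl⟩ := hA
      obtain ⟨y, hy, rfl⟩ := hA'
      exact (hd hx hy (fun h => hne (h ▸ rfl))).mono (hVU x) (hVU y)
  · refine iSup_le fun P => ?_
    have hm : ∀ U ∈ P.1, MeasurableSet (B ∩ U.1) := fun U _ => hB.inter
      (TopologicalSpace.isOpen_of_mem_countableBasis U.2).measurableSet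
    have hle : ∀ U ∈ P.1, (if Disjoint γ.carrier (B ∩ U.1) then (0 : ℝ≥0∞) else 1) ≤
        cnt γ (B ∩ U.1) := fun U hU => by
      split_ifs with h
      · exact zero_le
      · rw [cnt_apply γ (hm U hU)]
        rw [Set.not_disjoint_iff] at h
        obtain ⟨x, hx, hxB⟩ := h
        have : 1 ≤ (B ∩ U.1 ∩ γ.carrier).encard := Set.one_le_encard_iff_nonempty.2 ⟨x, hxB, hx⟩
        exact_mod_cast this
    refine (Finset.sum_le_sum hle).trans ?_
    rw [← measure_biUnion_finset ?_ hm]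
    · exact measure_mono (Set.iUnion₂_subset fun _ _ => Set.inter_subset_left)
    · intro A hA A' hA' hne
      exact (P.2 hA hA' hne).mono Set.inter_subset_right Set.inter_subset_right

lemma lintegral_cnt_eq_sum {d : ℕ} (γ : Conf d) {f : E d → ℝ≥0∞} {S : Set (E d)}
    (hS : IsCompact S) (hf : ∀ x, x ∉ S → f x = 0) :
    ∫⁻ x, f x ∂cnt γ = ∑ x ∈ (γ.locallyFinite S hS).toFinset, f x := by
  rw [lintegral_cnt, tsum_subtype γ.carrier f, tsum_eq_sum (s := (γ.locallyFinite S hS).toFinset)]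
  · refine Finset.sum_congr rfl fun x hx => ?_
    rw [Set.Finite.mem_toFinset] at hx
    exact Set.indicator_of_mem hx.1 f
  · intro x hx
    rw [Set.Finite.mem_toFinset] at hx
    by_cases h : x ∈ γ.carrier
    · rw [Set.indicator_of_mem h]
      exact hf x fun hxS => hx ⟨h, hxS⟩
    · exact Set.indicator_of_notMem h f

lemma pairing_eq_lintegral {d : ℕ} (γ : Conf d) (g : CompactlySupportedContinuousMap (E d) ℝ) :
    pairing g γ = (∫⁻ x, ENNReal.ofReal (g x) ∂cnt γ).toReal -
      (∫⁻ x, ENNReal.ofReal (-g x) ∂cnt γ).toReal := by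
  have hK := g.hasCompactSupport.isCompact
  have h0 : ∀ x, x ∉ tsupport g → g x = 0 := fun x hx => image_eq_zero_of_notMem_tsupport hx
  rw [pairing_eq_sum γ hK h0, lintegral_cnt_eq_sum γ hK fun x hx => by simp [h0 x hx],
    lintegral_cnt_eq_sum γ hK fun x hx => by simp [h0 x hx],
    ENNReal.toReal_sum fun _ _ => ENNReal.ofReal_ne_top,
    ENNReal.toReal_sum fun _ _ => ENNReal.ofReal_ne_top, ← Finset.sum_sub_distrib]
  refine Finset.sum_congr rfl fun x _ => ?_
  rw [ENNReal.toReal_ofReal', ENNReal.toReal_ofReal']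
  rcases le_total 0 (g x) with h | h
  · rw [max_eq_left h, max_eq_right (by linarith), sub_zero]
  · rw [max_eq_right h, max_eq_left (by linarith)]; ring

/-- The event that a configuration has no point in `B`. -/
def voidSet {d : ℕ} (B : Set (E d)) : Set (Conf d) := {γ | Disjoint γ.carrier B}

/-- A configuration-valued map is measurable as soon as its void events are. -/
lemma measurable_of_voidSet {d : ℕ} {Ω : Type*} [MeasurableSpace Ω] {c : Ω → Conf d}
    (h : ∀ B, MeasurableSet B → MeasurableSet (c ⁻¹' voidSet B)) : Measurable c := by
  classical
  have h1 : ∀ B, MeasurableSet B → Measurable fun ω => cnt (c ω) B := fun B hB => by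
    simp_rw [cnt_apply_eq_iSup _ hB]
    have : Countable (TopologicalSpace.countableBasis (E d)) :=
      (TopologicalSpace.countable_countableBasis (E d)).to_subtype
    refine Measurable.iSup fun P => Finset.measurable_fun_sum _ fun U _ => ?_
    refine Measurable.ite (h _ (hB.inter ?_)) measurable_const measurable_const
    exact (TopologicalSpace.isOpen_of_mem_countableBasis U.2).measurableSet
  have h2 : Measurable fun ω => cnt (c ω) := Measure.measurable_of_measurable_coe _ h1
  refine measurable_of_pairing fun g => ?_
  simp_rw [pairing_eq_lintegral]
  have hg := g.continuous.measurable
  exact ((Measure.measurable_lintegral hg.ennreal_ofReal).comp h2).ennreal_toReal.sub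
    ((Measure.measurable_lintegral hg.neg.ennreal_ofReal).comp h2).ennreal_toReal

lemma voidSet_eq {d : ℕ} {B : Set (E d)} (hB : MeasurableSet B) :
    voidSet B = {γ : Conf d | cnt γ B = 0} := by
  ext γ
  rw [voidSet, Set.mem_ofPred_eq, Set.mem_ofPred_eq, cnt_apply γ hB]
  simp [Set.disjoint_iff_inter_eq_empty, Set.inter_comm]

lemma measurableSet_voidSet {d : ℕ} {B : Set (E d)} (hB : MeasurableSet B) :
    MeasurableSet (voidSet B : Set (Conf d)) := by
  rw [voidSet_eq hB]
  exact measurable_cnt hB (measurableSet_singleton 0)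

lemma isPiSystem_voidSet (d : ℕ) :
    IsPiSystem {S : Set (Conf d) | ∃ B, MeasurableSet B ∧ S = voidSet B} := by
  rintro _ ⟨B, hB, rfl⟩ _ ⟨B', hB', rfl⟩ _
  refine ⟨B ∪ B', hB.union hB', ?_⟩
  ext γ
  simp [voidSet]

/-- The nontrivial inclusion is `measurable_of_voidSet` applied to the identity map. -/
lemma generateFrom_voidSet (d : ℕ) : instMeasurableSpaceConf d =
    MeasurableSpace.generateFrom {S : Set (Conf d) | ∃ B, MeasurableSet B ∧ S = voidSet B} := by
  apply le_antisymm
  · have := @measurable_of_voidSet d (Conf d)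
      (MeasurableSpace.generateFrom {S : Set (Conf d) | ∃ B, MeasurableSet B ∧ S = voidSet B})
      id fun B hB => MeasurableSpace.measurableSet_generateFrom ⟨B, hB, rfl⟩
    intro s hs
    exact this hs
  · refine MeasurableSpace.generateFrom_le ?_
    rintro _ ⟨B, hB, rfl⟩
    exact measurableSet_voidSet hB

/-! ### Sums over tuples of points of a configuration -/

/-- The counting measure on the `n`-tuples of points of a configuration. -/
def cntPi {d : ℕ} (n : ℕ) (γ : Conf d) : Measure (Fin n → E d) := Measure.pi fun _ => cnt γ

/-- The product measure is carried by the countable set of tuples of points of γ, each of which has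
mass one. -/
lemma lintegral_cntPi {d n : ℕ} (γ : Conf d) (f : (Fin n → E d) → ℝ≥0∞) :
    ∫⁻ x, f x ∂cntPi n γ = ∑' x : {x : Fin n → E d | ∀ i, x i ∈ γ.carrier}, f x := by
  have hc : {x : Fin n → E d | ∀ i, x i ∈ γ.carrier}.Countable :=
    Set.countable_pi fun _ => γ.countable
  have hae : ∀ᵐ x ∂cntPi n γ, x ∈ {x : Fin n → E d | ∀ i, x i ∈ γ.carrier} := by
    rw [Set.ofPred_forall]
    simp only [Set.mem_iInter, ae_all_iff]
    intro i
    refine (Measure.tendsto_eval_ae_ae (μ := fun _ : Fin n => cnt γ) (i := i)).eventually ?_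
    exact ae_restrict_mem γ.countable.measurableSet
  rw [← Measure.restrict_eq_self_of_ae_mem hae, lintegral_countable _ hc]
  refine tsum_congr fun x => ?_
  rw [cntPi, Measure.pi_singleton, Finset.prod_eq_one, mul_one]
  intro i _
  rw [cnt_apply γ (measurableSet_singleton _), Set.inter_eq_left.2]
  · simp
  · exact Set.singleton_subset_iff.2 (x.2 i)

lemma measurable_cntPi (d n : ℕ) : Measurable (cntPi n : Conf d → _) := by
  have h : ∀ m : ℕ, Measurable fun γ : Conf d =>
      (cntPi n γ).restrict (Set.univ.pi fun _ => Metric.closedBall 0 m) := fun m => by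
    simp only [cntPi, Measure.restrict_pi_pi]
    have hK := isCompact_closedBall (0 : E d) m
    have (γ : Conf d) : IsFiniteMeasure ((cnt γ).restrict (Metric.closedBall 0 m)) :=
      isFiniteMeasure_restrict.2 hK.measure_lt_top.ne
    have hB : ∀ B : Set (E d), MeasurableSet B →
        Measurable fun γ => (cnt γ).restrict (Metric.closedBall 0 m) B := fun B hB => by
      simp_rw [Measure.restrict_apply hB]
      exact measurable_cnt (hB.inter hK.measurableSet)
    refine Measurable.measure_of_isPiSystem generateFrom_pi.symm isPiSystem_pi ?_ ?_
    · rintro _ ⟨s, hs, rfl⟩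
      simp_rw [Measure.pi_pi]
      exact Finset.measurable_fun_prod _ fun i _ => hB _ (hs i trivial)
    · simp_rw [Measure.pi_univ]
      exact Finset.measurable_fun_prod _ fun i _ => hB _ .univ
  refine Measure.measurable_of_measurable_coe _ fun S hS => ?_
  have heq : ∀ γ : Conf d, cntPi n γ S =
      ⨆ m : ℕ, (cntPi n γ).restrict (Set.univ.pi fun _ => Metric.closedBall 0 m) S := by
    intro γ
    have : S = ⋃ m : ℕ, S ∩ (Set.univ.pi fun _ => Metric.closedBall 0 (m : ℝ)) := by
      rw [← Set.inter_iUnion, Set.iUnion_univ_pi_of_monotone, Metric.iUnion_closedBall_nat,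
        Set.pi_univ, Set.inter_univ]
      intro _ i j hij
      exact Metric.closedBall_subset_closedBall (by exact_mod_cast hij)
    conv_lhs => rw [this]
    rw [Monotone.measure_iUnion]
    · simp_rw [Measure.restrict_apply hS]
    · intro i j hij
      exact Set.inter_subset_inter_right _ (Set.pi_mono fun _ _ =>
        (Metric.closedBall_subset_closedBall (by exact_mod_cast hij)))
  simp_rw [heq]
  exact Measurable.iSup fun m => (Measure.measurable_coe hS).comp (h m)

/-! ### The `K`-transform and measurability on finite configurations -/

lemma measurableSet_injective (d : ℕ) (ι : Type*) [Countable ι] :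
    MeasurableSet {x : ι → E d | Function.Injective x} := by
  have : {x : ι → E d | Function.Injective x} = ⋂ (i) (j), {x | x i = x j → i = j} := by
    ext x; simp [Function.Injective]
  rw [this]
  refine MeasurableSet.iInter fun i => MeasurableSet.iInter fun j => ?_
  by_cases h : i = j
  · simp [h]
  · simp only [h, imp_false]
    exact (measurableSet_eq_fun (measurable_pi_apply i) (measurable_pi_apply j)).compl

/-- The set of values of a finite family of points, as a configuration. -/
def img {d : ℕ} {ι : Type*} [Fintype ι] (x : ι → E d) : FinConf d := by
  classical exact ⟨Finset.univ.image x⟩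

lemma mem_img {d : ℕ} {ι : Type*} [Fintype ι] {x : ι → E d} {y : E d} :
    y ∈ (img x).pts ↔ ∃ i, x i = y := by
  simp [img]

lemma tupleConf_eq_img {d n : ℕ} (x : Fin n → E d) : tupleConf x = img x := by
  unfold tupleConf img
  congr

lemma card_img {d : ℕ} {ι : Type*} [Fintype ι] {x : ι → E d} (hx : Function.Injective x) :
    (img x).pts.card = Fintype.card ι := by
  classical
  unfold img
  rw [Finset.card_image_of_injective _ hx, Finset.card_univ]

lemma card_img_le {d : ℕ} {ι : Type*} [Fintype ι] (x : ι → E d) :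
    (img x).pts.card ≤ Fintype.card ι := by
  classical
  unfold img
  exact Finset.card_image_le

lemma measurable_toConf (d : ℕ) : Measurable (FinConf.toConf : FinConf d → Conf d) :=
  comap_measurable _

lemma measurable_finConf_of_void {d : ℕ} {Ω : Type*} [MeasurableSpace Ω] {c : Ω → FinConf d}
    (h : ∀ B, MeasurableSet B → MeasurableSet {ω | ∀ x ∈ (c ω).pts, x ∉ B}) : Measurable c := by
  refine measurable_comap_iff.2 (measurable_of_voidSet fun B hB => ?_)
  convert h B hB using 1
  ext ω
  simp [voidSet, Set.disjoint_left, FinConf.toConf]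

lemma measurable_img {d : ℕ} {ι : Type*} [Fintype ι] :
    Measurable (img : (ι → E d) → FinConf d) := by
  refine measurable_finConf_of_void fun B hB => ?_
  have : {x : ι → E d | ∀ y ∈ (img x).pts, y ∉ B} = ⋂ i, {x | x i ∈ Bᶜ} := by
    ext x
    simp [mem_img]
  rw [this]
  exact MeasurableSet.iInter fun i => measurable_pi_apply i hB.compl

lemma measurable_tupleConf {d n : ℕ} : Measurable (tupleConf : (Fin n → E d) → FinConf d) := by
  simp_rw [funext (tupleConf_eq_img (d := d) (n := n))]
  exact measurable_img

/-- This turns an existential statement over the points of γ into a condition on a measurable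
function of γ. -/
lemma cntPi_ne_zero_iff {d n : ℕ} (γ : Conf d) {T : Set (Fin n → E d)} (hT : MeasurableSet T) :
    cntPi n γ T ≠ 0 ↔ ∃ x ∈ T, ∀ i, x i ∈ γ.carrier := by
  rw [← lintegral_indicator_one hT, lintegral_cntPi, Ne, ENNReal.tsum_eq_zero]
  simp only [not_forall, Subtype.exists, Set.mem_ofPred_eq, Set.indicator_apply_eq_zero]
  constructor
  · rintro ⟨x, hx, hxT, -⟩
    exact ⟨x, hxT, hx⟩
  · rintro ⟨x, hxT, hx⟩
    exact ⟨x, hx, hxT, by simp⟩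

lemma measurableSet_card_eq (d n : ℕ) : MeasurableSet {η : FinConf d | η.pts.card = n} := by
  have h := ((measurable_cnt (d := d) .univ).comp (measurable_toConf d))
    (measurableSet_singleton (n : ℝ≥0∞))
  convert h using 1
  ext η
  simp [cnt_apply _ MeasurableSet.univ, FinConf.toConf]

lemma tupleConf_eq_of_mem {d n : ℕ} {x : Fin n → E d} (hx : Function.Injective x) {η : FinConf d}
    (hη : η.pts.card = n) (h : ∀ i, x i ∈ η.pts) : tupleConf x = η := by
  rw [tupleConf_eq_img]
  ext1
  refine Finset.eq_of_subset_of_card_le (fun y hy => ?_) ?_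
  · obtain ⟨i, rfl⟩ := mem_img.1 hy
    exact h i
  · rw [card_img hx, Fintype.card_fin, hη]

lemma exists_tupleConf_eq {d : ℕ} (η : FinConf d) :
    ∃ x : Fin η.pts.card → E d, Function.Injective x ∧ tupleConf x = η :=
  ⟨fun i => (η.pts.equivFin.symm i : E d),
    Subtype.val_injective.comp η.pts.equivFin.symm.injective,
    tupleConf_eq_of_mem (Subtype.val_injective.comp η.pts.equivFin.symm.injective) rfl
      fun i => (η.pts.equivFin.symm i).2⟩

/-- A map on `Γ₀` is measurable as soon as its restrictions to tuples of distinct points are. -/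
lemma measurable_finConf {d : ℕ} {β : Type*} [MeasurableSpace β] {g : FinConf d → β}
    (h : ∀ n, Measurable fun x : {x : Fin n → E d // Function.Injective x} => g (tupleConf x.1)) :
    Measurable g := by
  intro S hS
  let T : ∀ n, Set (Fin n → E d) := fun n =>
    Subtype.val '' ((fun x : {x : Fin n → E d // Function.Injective x} => g (tupleConf x.1)) ⁻¹' S)
  have hT : ∀ n, MeasurableSet (T n) := fun n =>
    (measurableSet_injective d (Fin n)).subtype_image (h n hS)
  -- A tuple of n distinct points taken from an n-point configuration enumerates it, so finding one
  -- such tuple in `T n` already decides membership.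
  have : g ⁻¹' S = ⋃ n, {η | η.pts.card = n} ∩ {η | cntPi n η.toConf (T n) ≠ 0} := by
    ext η
    simp only [Set.mem_preimage, Set.mem_iUnion, Set.mem_inter_iff, Set.mem_ofPred_eq]
    constructor
    · intro hη
      obtain ⟨x, hx, hxη⟩ := exists_tupleConf_eq η
      refine ⟨_, rfl, (cntPi_ne_zero_iff _ (hT _)).2 ⟨x, ⟨⟨x, hx⟩, ?_, rfl⟩, fun i => ?_⟩⟩
      · simpa [hxη] using hη
      · have : x i ∈ (tupleConf x).pts := by rw [tupleConf_eq_img]; exact mem_img.2 ⟨i, rfl⟩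
        rw [hxη] at this
        exact this
    · rintro ⟨n, hn, hη⟩
      obtain ⟨_, ⟨x, hx, rfl⟩, hxη⟩ := (cntPi_ne_zero_iff _ (hT _)).1 hη
      have := tupleConf_eq_of_mem x.2 hn hxη
      rw [← this]
      exact hx
  rw [this]
  refine MeasurableSet.iUnion fun n => (measurableSet_card_eq d n).inter ?_
  exact (((Measure.measurable_coe (hT n)).comp ((measurable_cntPi d n).comp (measurable_toConf d)))
    (measurableSet_singleton 0)).compl

open scoped Classical in
-- An n-point configuration has exactly n! enumerations by injective tuples, namely the bijections
-- with `Fin n`; this is where the factor 1/n! in λ comes from.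
lemma tsum_injective_tupleConf (d n : ℕ) (g : FinConf d → ℝ≥0∞) :
    ∑' x : Fin n → E d, (if Function.Injective x then g (tupleConf x) else 0) =
      n.factorial * ∑' η : FinConf d, if η.pts.card = n then g η else 0 := by
  have hcard : ∀ η : FinConf d,
      ENat.card {x : {x : Fin n → E d // tupleConf x = η} // Function.Injective x.1} =
        if η.pts.card = n then (n.factorial : ℕ∞) else 0 := by
    intro η
    split_ifs with hη
    · let e : {x : {x : Fin n → E d // tupleConf x = η} // Function.Injective x.1} ≃
          (Fin n ≃ η.pts) :=
        { toFun := fun x => Equiv.ofBijective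
            (fun i => ⟨x.1.1 i, by
              have h : x.1.1 i ∈ (tupleConf x.1.1).pts := by
                rw [tupleConf_eq_img]
                exact mem_img.2 ⟨i, rfl⟩
              exact x.1.2.subst (motive := fun ζ => x.1.1 i ∈ ζ.pts) h⟩)
            ⟨fun i j hij => x.2 (congrArg Subtype.val hij), fun ⟨y, hy⟩ => by
              rw [← x.1.2, tupleConf_eq_img] at hy
              obtain ⟨i, hi⟩ := mem_img.1 hy
              exact ⟨i, Subtype.ext hi⟩⟩
          invFun := fun e => ⟨⟨fun i => (e i : E d), tupleConf_eq_of_mem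
            (Subtype.val_injective.comp e.injective) hη fun i => (e i).2⟩,
            Subtype.val_injective.comp e.injective⟩
          left_inv := fun x => rfl
          right_inv := fun e => by ext; rfl }
      rw [ENat.card_congr e, ENat.card_eq_coe_fintype_card,
        Fintype.card_equiv (η.pts.equivFinOfCardEq hη).symm, Fintype.card_fin]
    · rw [ENat.card_eq_zero_iff_empty]
      refine ⟨fun x => hη ?_⟩
      rw [← x.1.2, tupleConf_eq_img, card_img x.2, Fintype.card_fin]
  rw [← (Equiv.sigmaFiberEquiv (tupleConf : (Fin n → E d) → FinConf d)).tsum_eq,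
    ENNReal.tsum_sigma', ← ENNReal.tsum_mul_left]
  refine tsum_congr fun η => ?_
  have h1 : ∑' x : {x : Fin n → E d // tupleConf x = η},
      (if Function.Injective x.1 then g (tupleConf x.1) else 0) =
      ∑' _ : {x : {x : Fin n → E d // tupleConf x = η} // Function.Injective x.1}, g η := by
    have := tsum_subtype {x : {x : Fin n → E d // tupleConf x = η} | Function.Injective x.1}
      (fun _ => g η)
    refine Eq.trans ?_ this.symm
    refine tsum_congr fun x => ?_
    rw [x.2]
    simp only [Set.indicator_apply, Set.mem_ofPred_eq]
  refine h1.trans ?_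
  rw [ENNReal.tsum_const, hcard]
  split_ifs <;> simp

/-- Rewriting the sum over subsets as integrals against `cntPi` makes its dependence on γ
measurable. -/
lemma KTransform_eq_tsum {d : ℕ} (H : FinConf d → ℝ≥0∞) (γ : Conf d) :
    KTransform H γ = ∑' n : ℕ, (n.factorial : ℝ≥0∞)⁻¹ *
      ∫⁻ x in {x | Function.Injective x}, H (tupleConf x) ∂cntPi n γ := by
  classical
  let g : FinConf d → ℝ≥0∞ := fun η => if (η.pts : Set (E d)) ⊆ γ.carrier then H η else 0
  have h1 : ∀ n : ℕ, ∫⁻ x in {x | Function.Injective x}, H (tupleConf x) ∂cntPi n γ =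
      n.factorial * ∑' η : FinConf d, if η.pts.card = n then g η else 0 := fun n => by
    rw [← tsum_injective_tupleConf, ← lintegral_indicator (measurableSet_injective d _),
      lintegral_cntPi, tsum_subtype]
    refine tsum_congr fun x => ?_
    have hsub : (((tupleConf x).pts : Set (E d)) ⊆ γ.carrier) ↔ ∀ i, x i ∈ γ.carrier := by
      rw [tupleConf_eq_img]
      constructor
      · intro h i
        exact h (mem_img.2 ⟨i, rfl⟩)
      · intro h y hy
        obtain ⟨i, rfl⟩ := mem_img.1 hy
        exact h i
    simp only [Set.indicator_apply, Set.mem_ofPred_eq, g, hsub]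
    split_ifs <;> rfl
  have h2 : ∀ n : ℕ, (n.factorial : ℝ≥0∞)⁻¹ *
      ∫⁻ x in {x | Function.Injective x}, H (tupleConf x) ∂cntPi n γ =
      ∑' η : FinConf d, if η.pts.card = n then g η else 0 := fun n => by
    rw [h1, ← mul_assoc, ENNReal.inv_mul_cancel, one_mul]
    · exact_mod_cast n.factorial_ne_zero
    · exact ENNReal.natCast_ne_top _
  simp_rw [h2]
  rw [ENNReal.tsum_comm]
  have h3 : ∀ η : FinConf d, ∑' n : ℕ, (if η.pts.card = n then g η else 0) = g η := fun η => by
    rw [tsum_eq_single η.pts.card fun n hn => if_neg hn.symm, if_pos rfl]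
  simp_rw [h3]
  exact tsum_subtype {η : FinConf d | (η.pts : Set (E d)) ⊆ γ.carrier} H

lemma measurable_KTransform {d : ℕ} {H : FinConf d → ℝ≥0∞} (hH : Measurable H) :
    Measurable (KTransform H) := by
  simp_rw [funext (KTransform_eq_tsum H)]
  refine Measurable.tsum fun n => Measurable.const_mul ?_ _
  simp_rw [← lintegral_indicator (measurableSet_injective d (Fin n))]
  exact (Measure.measurable_lintegral ((hH.comp measurable_tupleConf).indicator
    (measurableSet_injective d _))).comp (measurable_cntPi d n)

/-- The index set varies with γ, so countable-infimum arguments do not apply directly. Instead, the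
infimum lies below c exactly when the `K`-transform of the indicator of {H < c} is non-zero. -/
lemma measurable_iInf_finConf {d : ℕ} {H : FinConf d → ℝ≥0∞} (hH : Measurable H) :
    Measurable fun γ : Conf d => ⨅ η : {η : FinConf d // (η.pts : Set (E d)) ⊆ γ.carrier}, H η := by
  refine measurable_of_Iio fun c => ?_
  have hm : MeasurableSet {η | H η < c} := hH measurableSet_Iio
  have : (fun γ : Conf d => ⨅ η : {η : FinConf d // (η.pts : Set (E d)) ⊆ γ.carrier}, H η) ⁻¹'
      Set.Iio c = {γ | KTransform ({η | H η < c}.indicator 1) γ ≠ 0} := by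
    ext γ
    rw [Set.mem_preimage, Set.mem_Iio, iInf_lt_iff, Set.mem_ofPred_eq, KTransform, Ne,
      ENNReal.tsum_eq_zero, not_forall]
    simp
  rw [this]
  exact (measurable_KTransform (measurable_one.indicator hm) (measurableSet_singleton 0)).compl

/-! ### Lebesgue–Poisson integrals and sums over subsets of an enumerated configuration. -/

lemma lintegral_lebesguePoisson {d : ℕ} {H : FinConf d → ℝ≥0∞} (hH : Measurable H) :
    ∫⁻ η, H η ∂lebesguePoisson d = ∑' n : ℕ, (n.factorial : ℝ≥0∞)⁻¹ *
      ∫⁻ x in {x : Fin n → E d | Function.Injective x}, H (tupleConf x) := by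
  rw [lebesguePoisson, lintegral_sum_measure]
  refine tsum_congr fun n => ?_
  rw [lintegral_smul_measure, lintegral_map hH measurable_tupleConf, smul_eq_mul]
  rfl

/-- The finite subsets of a configuration that is enumerated by `f`. -/
def finsetEquiv {d : ℕ} {α : Type*} {f : α → E d} (hf : Function.Injective f) {γ : Conf d}
    (hγ : Set.range f = γ.carrier) :
    Finset α ≃ {η : FinConf d // (η.pts : Set (E d)) ⊆ γ.carrier} := by
  classical
  refine Equiv.ofBijective (fun F => ⟨⟨F.image f⟩, ?_⟩) ⟨fun F F' h => ?_, fun η => ?_⟩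
  · rw [← hγ, Finset.coe_image]
    exact Set.image_subset_range _ _
  · exact Finset.image_injective hf (congrArg (fun η => η.1.pts) h)
  · have h : (η.1.pts : Set (E d)) ⊆ Set.range f := hγ.symm.subst η.2
    refine ⟨η.1.pts.preimage f hf.injOn, ?_⟩
    ext1
    ext1
    dsimp only
    rw [Finset.image_preimage]
    exact Finset.filter_true_of_mem fun x hx => h hx

open scoped Classical in
lemma finsetEquiv_apply {d : ℕ} {α : Type*} {f : α → E d} (hf : Function.Injective f) {γ : Conf d}
    (hγ : Set.range f = γ.carrier) (F : Finset α) : (finsetEquiv hf hγ F).1 = ⟨F.image f⟩ := by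
  simp only [finsetEquiv]
  congr

open scoped Classical in
-- With an injective enumeration the sum runs over sets of labels. For moving particles this index
-- set is not random, so the sum can be exchanged with the expectation.
lemma KTransform_eq_tsum_finset {d : ℕ} {α : Type*} {f : α → E d} (hf : Function.Injective f)
    {γ : Conf d} (hγ : Set.range f = γ.carrier) (H : FinConf d → ℝ≥0∞) :
    KTransform H γ = ∑' F : Finset α, H ⟨F.image f⟩ := by
  rw [KTransform, ← (finsetEquiv hf hγ).tsum_eq]
  simp_rw [finsetEquiv_apply]

/-! ### The transition probabilities of the random walk -/

/-- The jump kernel as a complex valued function. -/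
def jumpC {d : ℕ} (a : SchwartzMap (E d) ℝ) : SchwartzMap (E d) ℂ :=
  a.postcompCLM Complex.ofRealCLM

lemma jumpC_apply {d : ℕ} (a : SchwartzMap (E d) ℝ) (x : E d) : jumpC a x = (a x : ℂ) := rfl

/-- The `(n + 1)`-fold convolution power of the jump kernel. -/
def convPow {d : ℕ} (a : SchwartzMap (E d) ℝ) : ℕ → SchwartzMap (E d) ℂ
  | 0 => jumpC a
  | n + 1 => SchwartzMap.convolution (ContinuousLinearMap.mul ℂ ℂ) (jumpC a) (convPow a n)

lemma fourier_convPow {d : ℕ} (a : SchwartzMap (E d) ℝ) (n : ℕ) (ξ : E d) :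
    𝓕 (convPow a n : E d → ℂ) ξ = 𝓕 (jumpC a : E d → ℂ) ξ ^ (n + 1) := by
  induction n with
  | zero => simp [convPow]
  | succ n ih =>
    rw [pow_succ', ← ih, convPow, ← SchwartzMap.fourier_coe,
      SchwartzMap.fourier_convolution_apply,
      Real.fourier_mul_convolution_eq (jumpC a).integrable (convPow a n).integrable]

lemma convPow_eq_ofReal {d : ℕ} {a : SchwartzMap (E d) ℝ} (ha : ∀ x, 0 ≤ a x)
    (hs : ∀ x, a (-x) = a x) (n : ℕ) :
    ∃ β : E d → ℝ, (∀ x, convPow a n x = (β x : ℂ)) ∧ (∀ x, 0 ≤ β x) ∧ ∀ x, β (-x) = β x := by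
  induction n with
  | zero => exact ⟨a, fun x => rfl, ha, hs⟩
  | succ n ih =>
    obtain ⟨β, hβ, hβ0, hβs⟩ := ih
    refine ⟨fun x => ∫ y, a y * β (x - y), fun x => ?_, fun x => ?_, fun x => ?_⟩
    · rw [convPow, SchwartzMap.convolution_apply]
      refine Eq.trans ?_ integral_ofReal
      refine integral_congr_ae (.of_forall fun y => ?_)
      simp [jumpC_apply, hβ]
    · exact integral_nonneg fun y => mul_nonneg (ha y) (hβ0 _)
    · dsimp only
      rw [← integral_neg_eq_self]
      refine integral_congr_ae (.of_forall fun y => ?_)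
      dsimp only
      rw [hs, ← hβs]
      congr 2
      abel

/-- The real valued convolution powers. -/
def convPowR {d : ℕ} (a : SchwartzMap (E d) ℝ) (n : ℕ) (x : E d) : ℝ := (convPow a n x).re

lemma convPow_eq_convPowR {d : ℕ} {a : SchwartzMap (E d) ℝ}
    (ha : ∀ x, 0 ≤ a x) (hs : ∀ x, a (-x) = a x) (n : ℕ) (x : E d) :
    convPow a n x = (convPowR a n x : ℂ) := by
  obtain ⟨β, hβ, -, -⟩ := convPow_eq_ofReal ha hs n
  simp [convPowR, hβ]

lemma convPowR_nonneg {d : ℕ} {a : SchwartzMap (E d) ℝ}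
    (ha : ∀ x, 0 ≤ a x) (hs : ∀ x, a (-x) = a x) (n : ℕ) (x : E d) : 0 ≤ convPowR a n x := by
  obtain ⟨β, hβ, h0, -⟩ := convPow_eq_ofReal ha hs n
  simp [convPowR, hβ, h0]

lemma convPowR_neg {d : ℕ} {a : SchwartzMap (E d) ℝ}
    (ha : ∀ x, 0 ≤ a x) (hs : ∀ x, a (-x) = a x) (n : ℕ) (x : E d) :
    convPowR a n (-x) = convPowR a n x := by
  obtain ⟨β, hβ, -, hβs⟩ := convPow_eq_ofReal ha hs n
  simp [convPowR, hβ, hβs]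

lemma continuous_convPowR {d : ℕ} {a : SchwartzMap (E d) ℝ} (n : ℕ) : Continuous (convPowR a n) :=
  Complex.continuous_re.comp (convPow a n).continuous

lemma integrable_convPowR {d : ℕ} {a : SchwartzMap (E d) ℝ} (n : ℕ) : Integrable (convPowR a n) :=
  (convPow a n).integrable.re

lemma fourier_zero_eq {d : ℕ} (f : E d → ℂ) : 𝓕 f 0 = ∫ x, f x := by
  simp [Real.fourier_eq]

lemma integral_convPowR {d : ℕ} {a : SchwartzMap (E d) ℝ}
    (ha : ∀ x, 0 ≤ a x) (hs : ∀ x, a (-x) = a x)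
    (h1 : ∫ x, a x = 1) (n : ℕ) : ∫ x, convPowR a n x = 1 := by
  have h := fourier_convPow a n 0
  rw [fourier_zero_eq, fourier_zero_eq] at h
  simp_rw [convPow_eq_convPowR ha hs, jumpC_apply] at h
  have h2 : ∫ x, (a x : ℂ) = ((∫ x, a x : ℝ) : ℂ) := integral_ofReal
  rw [h2, h1] at h
  rw [Complex.ofReal_one, one_pow] at h
  exact Complex.ofReal_eq_one.1 (integral_ofReal.symm.trans h)

lemma norm_fourier_jumpC_le {d : ℕ} {a : SchwartzMap (E d) ℝ}
    (ha : ∀ x, 0 ≤ a x) (h1 : ∫ x, a x = 1) (ξ : E d) : ‖𝓕 (jumpC a : E d → ℂ) ξ‖ ≤ 1 := by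
  rw [Real.fourier_eq]
  refine (norm_integral_le_integral_norm _).trans ?_
  simp only [Circle.norm_smul, jumpC_apply, Complex.norm_real, Real.norm_of_nonneg (ha _), h1,
    le_refl]

/-- Expand the exponential and apply Fourier inversion to each convolution power. Since |𝓕a| ≤ 1,
every power of 𝓕a is dominated by |𝓕a|, which is integrable, so the summable coefficients justify
termwise integration. -/
lemma hasSum_walkDensity {d : ℕ} {a : SchwartzMap (E d) ℝ}
    (ha : ∀ x, 0 ≤ a x) (hs : ∀ x, a (-x) = a x)
    (h1 : ∫ x, a x = 1) (t : ℝ≥0) (x : E d) :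
    HasSum (fun n : ℕ => Real.exp (-t) * ((t : ℝ) ^ (n + 1) / (n + 1).factorial) * convPowR a n x)
      (walkDensity a t x) := by
  set A : E d → ℂ := 𝓕 (jumpC a : E d → ℂ) with hA
  have hAint : Integrable A := (𝓕 (jumpC a)).integrable
  have hAcont : Continuous A := (𝓕 (jumpC a)).continuous
  let c : ℕ → ℝ := fun n => Real.exp (-t) * ((t : ℝ) ^ (n + 1) / (n + 1).factorial)
  have hc0 : ∀ n, 0 ≤ c n := fun n => by positivity
  let F : ℕ → E d → ℂ := fun n ξ => Real.fourierChar (inner ℝ ξ x) • ((c n : ℂ) * A ξ ^ (n + 1))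
  have hpow : ∀ n, Integrable fun ξ => A ξ ^ (n + 1) := fun n => by
    simp_rw [hA, ← fourier_convPow]
    exact (𝓕 (convPow a n)).integrable
  have hFnorm : ∀ n ξ, ‖F n ξ‖ = c n * ‖A ξ ^ (n + 1)‖ := fun n ξ => by
    simp only [F, Circle.norm_smul, norm_mul, Complex.norm_real, Real.norm_of_nonneg (hc0 n)]
  have hF : ∀ n, Integrable (F n) := fun n => by
    refine ((hpow n).norm.const_mul (c n)).mono' ?_ (.of_forall fun ξ => (hFnorm n ξ).le)
    refine Continuous.aestronglyMeasurable ?_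
    simp only [F, Circle.smul_def]
    have := Real.continuous_fourierChar
    fun_prop
  have hsum : Summable fun n => ∫ ξ, ‖F n ξ‖ := by
    have hcs : Summable c := by
      refine Summable.mul_left _ ?_
      exact (summable_nat_add_iff 1).2 (Real.summable_pow_div_factorial (t : ℝ))
    refine (hcs.mul_right (∫ ξ, ‖A ξ‖)).of_nonneg_of_le
      (fun n => integral_nonneg fun _ => norm_nonneg _) fun n => ?_
    simp_rw [hFnorm]
    rw [integral_const_mul]
    refine mul_le_mul_of_nonneg_left ?_ (hc0 n)
    refine integral_mono (hpow n).norm hAint.norm fun ξ => ?_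
    dsimp only
    rw [norm_pow]
    exact pow_le_of_le_one (norm_nonneg _) (norm_fourier_jumpC_le ha h1 ξ) n.succ_ne_zero
  have key := hasSum_integral_of_summable_integral_norm hF hsum
  have hlhs : ∀ n, ∫ ξ, F n ξ = ((c n * convPowR a n x : ℝ) : ℂ) := fun n => by
    have h2 : 𝓕⁻ (𝓕 (convPow a n : E d → ℂ)) x = convPow a n x := by
      rw [Continuous.fourierInv_fourier_eq (convPow a n).continuous (convPow a n).integrable
        (𝓕 (convPow a n)).integrable]
    rw [Real.fourierInv_eq] at h2
    simp_rw [fourier_convPow, convPow_eq_convPowR ha hs] at h2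
    rw [Complex.ofReal_mul, ← h2, ← integral_const_mul]
    refine integral_congr_ae (.of_forall fun ξ => ?_)
    simp only [F, Circle.smul_def, smul_eq_mul, hA]
    ring
  have hrhs : ∫ ξ, ∑' n, F n ξ = 𝓕⁻ (fun ξ : E d => (Real.exp (-(t : ℝ)) : ℂ) *
    (Complex.exp ((t : ℂ) * A ξ) - 1)) x := by
    rw [Real.fourierInv_eq]
    refine integral_congr_ae (.of_forall fun ξ => ?_)
    dsimp only
    have he : HasSum (fun n : ℕ => ((t : ℂ) * A ξ) ^ (n + 1) / (n + 1).factorial)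
        (Complex.exp ((t : ℂ) * A ξ) - 1) := by
      have := NormedSpace.expSeries_div_hasSum_exp ((t : ℂ) * A ξ)
      rw [← Complex.exp_eq_exp_ℂ] at this
      simpa using (hasSum_nat_add_iff' 1).2 this
    have := ((he.mul_left (Real.exp (-(t : ℝ)) : ℂ)).const_smul
      (Real.fourierChar (inner ℝ ξ x)))
    rw [← this.tsum_eq]
    refine tsum_congr fun n => ?_
    simp only [F, c]
    push_cast
    congr 1
    rw [mul_pow]
    ring
  rw [hrhs] at key
  simp_rw [hlhs] at key
  exact Complex.hasSum_re key

lemma walkDensity_neg {d : ℕ} {a : SchwartzMap (E d) ℝ} (ha : ∀ x, 0 ≤ a x) (hs : ∀ x, a (-x) = a x)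
    (h1 : ∫ x, a x = 1) (t : ℝ≥0) (x : E d) : walkDensity a t (-x) = walkDensity a t x := by
  have h := hasSum_walkDensity ha hs h1 t (-x)
  simp_rw [convPowR_neg ha hs] at h
  exact h.unique (hasSum_walkDensity ha hs h1 t x)

lemma ofReal_walkDensity {d : ℕ} {a : SchwartzMap (E d) ℝ}
    (ha : ∀ x, 0 ≤ a x) (hs : ∀ x, a (-x) = a x)
    (h1 : ∫ x, a x = 1) (t : ℝ≥0) (x : E d) : ENNReal.ofReal (walkDensity a t x) =
    ∑' n : ℕ, ENNReal.ofReal (Real.exp (-t) * ((t : ℝ) ^ (n + 1) / (n + 1).factorial) *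
      convPowR a n x) := by
  have h := hasSum_walkDensity ha hs h1 t x
  rw [← h.tsum_eq, ENNReal.ofReal_tsum_of_nonneg _ h.summable]
  exact fun n => mul_nonneg (by positivity) (convPowR_nonneg ha hs n x)

/-- Each convolution power has mass one, so the total is the exponential series without its zeroth
term; the missing e^{-t} is the weight of the Dirac part. -/
lemma lintegral_walkDensity {d : ℕ} {a : SchwartzMap (E d) ℝ}
    (ha : ∀ x, 0 ≤ a x) (hs : ∀ x, a (-x) = a x)
    (h1 : ∫ x, a x = 1) (t : ℝ≥0) :
    ∫⁻ x, ENNReal.ofReal (walkDensity a t x) = ENNReal.ofReal (1 - Real.exp (-t)) := by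
  simp_rw [ofReal_walkDensity ha hs h1]
  rw [lintegral_tsum fun n =>
    ((continuous_convPowR n).measurable.const_mul _).ennreal_ofReal.aemeasurable]
  have h2 : ∀ n : ℕ, ∫⁻ x, ENNReal.ofReal (Real.exp (-t) *
      ((t : ℝ) ^ (n + 1) / (n + 1).factorial) * convPowR a n x) =
      ENNReal.ofReal (Real.exp (-t) * ((t : ℝ) ^ (n + 1) / (n + 1).factorial)) := fun n => by
    rw [← ofReal_integral_eq_lintegral_ofReal ((integrable_convPowR n).const_mul _)
      (.of_forall fun x => mul_nonneg (by positivity) (convPowR_nonneg ha hs n x)),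
      integral_const_mul, integral_convPowR ha hs h1, mul_one]
  simp_rw [h2]
  have he : HasSum (fun n : ℕ => Real.exp (-t) * ((t : ℝ) ^ (n + 1) / (n + 1).factorial))
      (1 - Real.exp (-t)) := by
    have := NormedSpace.expSeries_div_hasSum_exp (t : ℝ)
    rw [← Real.exp_eq_exp_ℝ] at this
    have := ((hasSum_nat_add_iff' 1).2 this).mul_left (Real.exp (-t))
    rw [mul_sub, ← Real.exp_add] at this
    simpa using this
  rw [← ENNReal.ofReal_tsum_of_nonneg (fun n => by positivity) he.summable, he.tsum_eq]

lemma isProbabilityMeasure_walkKernel {d : ℕ} {a : SchwartzMap (E d) ℝ}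
    (ha : ∀ x, 0 ≤ a x) (hs : ∀ x, a (-x) = a x)
    (h1 : ∫ x, a x = 1) (t : ℝ≥0) (x : E d) :
    IsProbabilityMeasure (walkKernel a t x) := by
  constructor
  rw [walkKernel, Measure.add_apply, Measure.smul_apply, withDensity_apply _ .univ,
    Measure.restrict_univ,
    lintegral_sub_left_eq_self (fun y => ENNReal.ofReal (walkDensity a t y)),
    lintegral_walkDensity ha hs h1]
  simp only [measure_univ, smul_eq_mul, mul_one]
  rw [← ENNReal.ofReal_add (Real.exp_pos _).le (by simp)]
  simp

lemma indicator_preimage_apply {α β γ : Type*} [Zero γ] (f : α → β) (S : Set β) (g : α → γ)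
    (z : α) : (f ⁻¹' S).indicator g z = S.indicator (fun _ => g z) (f z) := by
  by_cases h : f z ∈ S
  · rw [Set.indicator_of_mem h, Set.indicator_of_mem (Set.mem_preimage.2 h)]
  · rw [Set.indicator_of_notMem h, Set.indicator_of_notMem (fun h' => h (Set.mem_preimage.1 h'))]

/-- Spatial homogeneity reduces all particles to the single displacement law `walkKernel a t 0`. -/
lemma walkKernel_eq_map {d : ℕ} (a : SchwartzMap (E d) ℝ) (t : ℝ≥0) (x : E d) :
    walkKernel a t x = (walkKernel a t 0).map (x + ·) := by
  have hm : Measurable fun y : E d => x + y := measurable_const_add x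
  ext S hS
  rw [Measure.map_apply hm hS, walkKernel, walkKernel, Measure.add_apply, Measure.add_apply,
    withDensity_apply _ hS, withDensity_apply _ (hm hS), Measure.smul_apply, Measure.smul_apply,
    Measure.dirac_apply' _ hS, Measure.dirac_apply' _ (hm hS), ← lintegral_indicator hS,
    ← lintegral_indicator (hm hS),
    ← lintegral_add_left_eq_self (fun y => S.indicator _ y) x]
  congr 1
  · rw [indicator_preimage_apply, add_zero]
    rfl
  · refine lintegral_congr fun y => ?_
    rw [indicator_preimage_apply]
    simp [Set.indicator]

lemma walkKernel_map_neg {d : ℕ} {a : SchwartzMap (E d) ℝ}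
    (ha : ∀ x, 0 ≤ a x) (hs : ∀ x, a (-x) = a x)
    (h1 : ∫ x, a x = 1) (t : ℝ≥0) : (walkKernel a t 0).map Neg.neg = walkKernel a t 0 := by
  have hm : Measurable fun y : E d => -y := measurable_neg
  ext S hS
  change (walkKernel a t 0).map (fun y => -y) S = _
  rw [Measure.map_apply hm hS, walkKernel, Measure.add_apply, Measure.add_apply,
    withDensity_apply _ hS, withDensity_apply _ (hm hS), Measure.smul_apply, Measure.smul_apply,
    Measure.dirac_apply' _ hS, Measure.dirac_apply' _ (hm hS), ← lintegral_indicator hS,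
    ← lintegral_indicator (hm hS), ← lintegral_neg_eq_self (fun y => S.indicator _ y)]
  congr 1
  · rw [indicator_preimage_apply, neg_zero]
    rfl
  · refine lintegral_congr fun y => ?_
    rw [indicator_preimage_apply]
    simp [Set.indicator, walkDensity_neg ha hs h1]

/-- For d ≥ 1 points are Lebesgue null, so only the Dirac part at the origin can charge a point. -/
lemma walkKernel_singleton_eq_zero {d : ℕ} (a : SchwartzMap (E d) ℝ)
    (hd : 1 ≤ d) (t : ℝ≥0) {v : E d} (hv : v ≠ 0) :
    walkKernel a t 0 {v} = 0 := by
  have : Nonempty (Fin d) := ⟨⟨0, hd⟩⟩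
  have : Nontrivial (E d) := inferInstance
  rw [walkKernel, Measure.add_apply, Measure.smul_apply,
    Measure.dirac_apply' _ (measurableSet_singleton v)]
  simp [Set.indicator, hv.symm]

/-! ### Independent displacements of finite configurations -/

/-- The law of a family of independent displacements, one for each point of space. -/
def disp {d : ℕ} (ν : Measure (E d)) : Measure (E d → E d) := Measure.infinitePi fun _ => ν

instance {d : ℕ} (ν : Measure (E d)) [IsProbabilityMeasure ν] : IsProbabilityMeasure (disp ν) := by
  unfold disp; infer_instance

open scoped Classical in
/-- The finite configuration `{x + z(x) ∣ x ∈ η}`. -/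
def moved {d : ℕ} (z : E d → E d) (η : FinConf d) : FinConf d := ⟨η.pts.image fun x => x + z x⟩

lemma mem_moved {d : ℕ} {z : E d → E d} {η : FinConf d} {y : E d} :
    y ∈ (moved z η).pts ↔ ∃ x ∈ η.pts, x + z x = y := by
  simp [moved]

lemma moved_img {d : ℕ} {ι : Type*} [Fintype ι] (z : E d → E d) (x : ι → E d) :
    moved z (img x) = img fun i => x i + z (x i) := by
  ext y
  simp [mem_moved, mem_img]

lemma measurable_moved {d : ℕ} (η : FinConf d) :
    Measurable fun z : E d → E d => moved z η := by
  refine measurable_finConf_of_void fun B hB => ?_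
  have : {z : E d → E d | ∀ y ∈ (moved z η).pts, y ∉ B} =
      ⋂ x ∈ η.pts, {z | x + z x ∈ Bᶜ} := by
    ext z
    simp [mem_moved]
  rw [this]
  refine Finset.measurableSet_biInter _ fun x _ => ?_
  have hm : Measurable fun z : E d → E d => x + z x :=
    Measurable.const_add (f := fun z : E d → E d => z x) (measurable_pi_apply x) x
  exact hm hB.compl

/-- Injectivity is essential: displacements are attached to points of space, so repeated entries
would share one displacement instead of having independent ones. -/
lemma disp_map {d : ℕ} (ν : Measure (E d)) [IsProbabilityMeasure ν] {ι : Type*} [Fintype ι]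
    {x : ι → E d} (hx : Function.Injective x) :
    (disp ν).map (fun z i => z (x i)) = Measure.pi fun _ : ι => ν := by
  rw [disp, Measure.map_infinitePi_infinitePi_of_inj (P := fun _ : E d => ν) hx,
    Measure.infinitePi_eq_pi]

lemma lintegral_moved_img {d : ℕ} (ν : Measure (E d)) [IsProbabilityMeasure ν] {ι : Type*}
    [Fintype ι] {x : ι → E d} (hx : Function.Injective x) {H : FinConf d → ℝ≥0∞}
    (hH : Measurable H) :
    ∫⁻ z, H (moved z (img x)) ∂disp ν = ∫⁻ z, H (img (x + z)) ∂Measure.pi fun _ : ι => ν := by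
  rw [← disp_map ν hx, lintegral_map]
  · simp_rw [moved_img]
    rfl
  · exact hH.comp (measurable_img.comp (measurable_const_add x))
  · exact measurable_pi_lambda _ fun i => measurable_pi_apply _

lemma integral_moved_img {d : ℕ} (ν : Measure (E d)) [IsProbabilityMeasure ν] {ι : Type*}
    [Fintype ι] {x : ι → E d} (hx : Function.Injective x) {k : FinConf d → ℝ}
    (hk : Measurable k) :
    ∫ z, k (moved z (img x)) ∂disp ν = ∫ z, k (img (x + z)) ∂Measure.pi fun _ : ι => ν := by
  rw [← disp_map ν hx, integral_map]
  · simp_rw [moved_img]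
    rfl
  · exact (measurable_pi_lambda _ fun i => measurable_pi_apply _).aemeasurable
  · exact (hk.comp (measurable_img.comp (measurable_const_add x))).aestronglyMeasurable

/-- Given the displacement u of x, a collision forces the displacement x + u - y on y. This value is
null unless it is zero, and it is zero only for u = y - x ≠ 0, which is itself null. -/
lemma ae_add_ne {d : ℕ} {ν : Measure (E d)} [IsProbabilityMeasure ν]
    (hν : ∀ v, v ≠ 0 → ν {v} = 0) {x y : E d} (hxy : x ≠ y) :
    ∀ᵐ z ∂disp ν, x + z x ≠ y + z y := by
  have hm : Measurable fun z : E d → E d => (z x, z y) :=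
    (measurable_pi_apply x).prodMk (measurable_pi_apply y)
  have hS : MeasurableSet {p : E d × E d | x + p.1 = y + p.2} :=
    measurableSet_eq_fun (measurable_fst.const_add x) (measurable_snd.const_add y)
  have h : (disp ν).map (fun z => (z x, z y)) = ν.prod ν :=
    Measure.infinitePi_map_eval_prod (P := fun _ : E d => ν) hxy
  have h0 : (ν.prod ν) {p : E d × E d | x + p.1 = y + p.2} = 0 := by
    rw [Measure.prod_apply hS, lintegral_eq_zero_iff (measurable_measure_prodMk_left hS)]
    have hne : ∀ᵐ u ∂ν, u ≠ y - x := by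
      rw [ae_iff]
      simpa using hν (y - x) (sub_ne_zero.2 hxy.symm)
    filter_upwards [hne] with u hu
    have : Prod.mk u ⁻¹' {p : E d × E d | x + p.1 = y + p.2} = {x + u - y} := by
      ext w
      rw [Set.mem_preimage, Set.mem_ofPred_eq, Set.mem_singleton_iff, eq_sub_iff_add_eq, eq_comm,
        add_comm w]
    rw [this]
    refine hν _ fun h => hu ?_
    rw [sub_eq_zero] at h
    rw [← h]
    abel
  rw [← h, Measure.map_apply hm hS] at h0
  rw [ae_iff]
  simpa using h0

lemma ae_injOn {d : ℕ} {ν : Measure (E d)} [IsProbabilityMeasure ν]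
    (hν : ∀ v, v ≠ 0 → ν {v} = 0) {S : Set (E d)} (hS : S.Countable) :
    ∀ᵐ z ∂disp ν, Set.InjOn (fun x => x + z x) S := by
  have h : ∀ᵐ z ∂disp ν, ∀ x ∈ S, ∀ y ∈ S, x ≠ y → x + z x ≠ y + z y := by
    refine (ae_ball_iff hS).2 fun x _ => (ae_ball_iff hS).2 fun y _ => ?_
    by_cases hxy : x = y
    · exact .of_forall fun z h => absurd hxy h
    · filter_upwards [ae_add_ne hν hxy] with z hz _ using hz
  filter_upwards [h] with z hz x hx y hy hxy
  by_contra hne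
  exact hz x hx y hy hne hxy

lemma ae_pi_injective {d : ℕ} {ν : Measure (E d)} [IsProbabilityMeasure ν]
    (hν : ∀ v, v ≠ 0 → ν {v} = 0) {ι : Type*} [Fintype ι] {x : ι → E d}
    (hx : Function.Injective x) :
    ∀ᵐ z ∂Measure.pi fun _ : ι => ν, Function.Injective (x + z) := by
  rw [← disp_map ν hx, ae_map_iff]
  · filter_upwards [ae_injOn hν (Set.finite_range x).countable] with z hz i j hij
    exact hx (hz ⟨i, rfl⟩ ⟨j, rfl⟩ hij)
  · exact (measurable_pi_lambda _ fun i => measurable_pi_apply _).aemeasurable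
  · exact (measurable_const_add x) (measurableSet_injective d ι)

/-- The functional `η ↦ 𝔼 k({x + z(x) ∣ x ∈ η})`. -/
def evolved {d : ℕ} (ν : Measure (E d)) (k : FinConf d → ℝ) (η : FinConf d) : ℝ :=
  ∫ z, k (moved z η) ∂disp ν

/-- The functional `η ↦ 𝔼 H({x + z(x) ∣ x ∈ η})` for non-negative `H`. -/
def levolved {d : ℕ} (ν : Measure (E d)) (H : FinConf d → ℝ≥0∞) (η : FinConf d) : ℝ≥0∞ :=
  ∫⁻ z, H (moved z η) ∂disp ν

/-- On tuples of distinct points the expectation over the uncountable product becomes an integral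
over a fixed finite product, where joint measurability in starting points and displacements is
available. -/
lemma measurable_evolved {d : ℕ} (ν : Measure (E d)) [IsProbabilityMeasure ν] {k : FinConf d → ℝ}
    (hk : Measurable k) : Measurable (evolved ν k) := by
  refine measurable_finConf fun n => ?_
  have h : ∀ x : {x : Fin n → E d // Function.Injective x}, evolved ν k (tupleConf x.1) =
      ∫ z, k (img (x.1 + z)) ∂Measure.pi fun _ : Fin n => ν := fun x => by
    rw [tupleConf_eq_img, evolved, integral_moved_img ν x.2 hk]
  simp_rw [h]
  refine StronglyMeasurable.measurable (StronglyMeasurable.integral_prod_right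
    (f := fun (x : {x : Fin n → E d // Function.Injective x}) z => k (img (x.1 + z))) ?_)
  refine (hk.comp (measurable_img.comp ?_)).stronglyMeasurable
  exact (measurable_subtype_coe.comp measurable_fst).add measurable_snd

lemma measurable_levolved {d : ℕ} (ν : Measure (E d)) [IsProbabilityMeasure ν]
    {H : FinConf d → ℝ≥0∞} (hH : Measurable H) : Measurable (levolved ν H) := by
  refine measurable_finConf fun n => ?_
  have h : ∀ x : {x : Fin n → E d // Function.Injective x}, levolved ν H (tupleConf x.1) =
      ∫⁻ z, H (img (x.1 + z)) ∂Measure.pi fun _ : Fin n => ν := fun x => by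
    rw [tupleConf_eq_img, levolved, lintegral_moved_img ν x.2 hH]
  simp_rw [h]
  refine Measurable.lintegral_prod_right'
    (f := fun p : {x : Fin n → E d // Function.Injective x} × (Fin n → E d) =>
      H (img (p.1.1 + p.2))) ?_
  refine hH.comp (measurable_img.comp ?_)
  exact (measurable_subtype_coe.comp measurable_fst).add measurable_snd

/-- Symmetry of a random walk with symmetric displacements. -/
lemma lintegral_add_mul_symm {G : Type*} [AddCommGroup G] [MeasurableSpace G] [MeasurableAdd₂ G]
    [MeasurableNeg G] (m P : Measure G) [SFinite m] [SFinite P] [m.IsAddRightInvariant]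
    [P.IsNegInvariant] {F K : G → ℝ≥0∞} (hF : Measurable F) (hK : Measurable K) :
    ∫⁻ x, (∫⁻ z, F (x + z) ∂P) * K x ∂m = ∫⁻ y, F y * ∫⁻ z, K (y + z) ∂P ∂m := by
  have h1 : ∀ x, (∫⁻ z, F (x + z) ∂P) * K x = ∫⁻ z, F (x + z) * K x ∂P := fun x =>
    (lintegral_mul_const _ (hF.comp (measurable_const_add x))).symm
  have h2 : ∀ y, F y * ∫⁻ z, K (y + z) ∂P = ∫⁻ z, F y * K (y + -z) ∂P := fun y => by
    have hm : Measurable fun z => K (y + -z) := hK.comp (measurable_neg.const_add y)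
    rw [lintegral_const_mul _ hm,
      lintegral_neg_eq_self (μ := P) (fun z => K (y + z))]
  simp_rw [h1, h2]
  have hm1 : Measurable (Function.uncurry fun x z => F (x + z) * K x) :=
    (hF.comp (measurable_fst.add measurable_snd)).mul (hK.comp measurable_fst)
  have hm2 : Measurable (Function.uncurry fun y z => F y * K (y + -z)) :=
    (hF.comp measurable_fst).mul (hK.comp (measurable_fst.add measurable_snd.neg))
  rw [lintegral_lintegral_swap (f := fun x z => F (x + z) * K x) hm1.aemeasurable,
    lintegral_lintegral_swap (f := fun y z => F y * K (y + -z)) hm2.aemeasurable]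
  refine lintegral_congr fun z => ?_
  -- For fixed z, translating y by z turns the right integrand into F(y + z) K(y), the left one.
  rw [← lintegral_add_right_eq_self (μ := m) (fun y => F y * K (y + -z)) z]
  simp

/-- Each coincidence set {x i = x j} is the kernel of a non-zero linear map, hence a null proper
subspace; d ≥ 1 provides the vector that shows it is proper. -/
lemma ae_injective {d : ℕ} (hd : 1 ≤ d) (n : ℕ) :
    ∀ᵐ x : Fin n → E d, Function.Injective x := by
  have : Nonempty (Fin d) := ⟨⟨0, hd⟩⟩
  have : Nontrivial (E d) := inferInstance
  have h : ∀ i j : Fin n, i ≠ j → ∀ᵐ x : Fin n → E d, x i ≠ x j := fun i j hij => by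
    rw [ae_iff]
    have hlt : (LinearMap.ker (LinearMap.proj (R := ℝ) (φ := fun _ : Fin n => E d) i -
        LinearMap.proj j)) ≠ ⊤ := fun h => by
      obtain ⟨v, hv⟩ := exists_ne (0 : E d)
      have hmem : (Pi.single i v : Fin n → E d) ∈ LinearMap.ker (LinearMap.proj (R := ℝ)
          (φ := fun _ : Fin n => E d) i - LinearMap.proj j) := h ▸ Submodule.mem_top
      rw [LinearMap.mem_ker] at hmem
      simp [Pi.single_eq_of_ne hij.symm] at hmem
      exact hv hmem
    have := Measure.addHaar_submodule (volume : Measure (Fin n → E d)) _ hlt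
    refine measure_mono_null (fun x hx => ?_) this
    simp only [Set.mem_ofPred_eq, not_not] at hx
    simp [hx]
  have h' : ∀ᵐ x : Fin n → E d, ∀ i j, i ≠ j → x i ≠ x j := by
    refine ae_all_iff.2 fun i => ae_all_iff.2 fun j => ?_
    by_cases hij : i = j
    · exact .of_forall fun x h => absurd hij h
    · filter_upwards [h i j hij] with x hx _ using hx
  filter_upwards [h'] with x hx i j hij
  by_contra hne
  exact hx i j hne hij

/-- The duality between the evolution of observables and of correlation functionals. -/
lemma lintegral_levolved_mul {d : ℕ} (hd : 1 ≤ d) (ν : Measure (E d)) [IsProbabilityMeasure ν]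
    [ν.IsNegInvariant] {H K : FinConf d → ℝ≥0∞} (hH : Measurable H) (hK : Measurable K) :
    ∫⁻ η, levolved ν H η * K η ∂lebesguePoisson d =
      ∫⁻ η, H η * levolved ν K η ∂lebesguePoisson d := by
  rw [lintegral_lebesguePoisson (H := fun η => levolved ν H η * K η)
      ((measurable_levolved ν hH).mul hK),
    lintegral_lebesguePoisson (H := fun η => H η * levolved ν K η)
      (hH.mul (measurable_levolved ν hK))]
  refine tsum_congr fun n => ?_
  congr 1
  have : (Measure.pi fun _ : Fin n => ν).IsNegInvariant :=
    Measure.pi.isNegInvariant (fun _ : Fin n => ν)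
  have hr : (volume : Measure (Fin n → E d)).restrict {x | Function.Injective x} = volume :=
    Measure.restrict_eq_self_of_ae_mem (ae_injective hd n)
  have hl : ∀ L : FinConf d → ℝ≥0∞, Measurable L → ∀ x : Fin n → E d, Function.Injective x →
      levolved ν L (tupleConf x) = ∫⁻ z, L (img (x + z)) ∂Measure.pi fun _ : Fin n => ν :=
    fun L hL x hx => by rw [tupleConf_eq_img, levolved, lintegral_moved_img ν hx hL]
  rw [hr]
  calc ∫⁻ x : Fin n → E d, levolved ν H (tupleConf x) * K (tupleConf x)
      = ∫⁻ x : Fin n → E d, (∫⁻ z, H (img (x + z)) ∂Measure.pi fun _ : Fin n => ν) * K (img x) := by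
        refine lintegral_congr_ae ?_
        filter_upwards [ae_injective hd n] with x hx
        rw [hl H hH x hx, tupleConf_eq_img]
    _ = ∫⁻ y : Fin n → E d, H (img y) * ∫⁻ z, K (img (y + z)) ∂Measure.pi fun _ : Fin n => ν :=
        lintegral_add_mul_symm volume (Measure.pi fun _ : Fin n => ν)
          (hH.comp measurable_img) (hK.comp measurable_img)
    _ = _ := by
        refine lintegral_congr_ae ?_
        filter_upwards [ae_injective hd n] with x hx
        rw [hl K hK x hx, tupleConf_eq_img]

/-! ### The transition function of independent particles -/

instance instIsProbabilityMeasureMapAdd {d : ℕ} (ν : Measure (E d)) [IsProbabilityMeasure ν]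
    (x : E d) : IsProbabilityMeasure (ν.map (x + ·)) :=
  Measure.isProbabilityMeasure_map (measurable_const_add x).aemeasurable

/-- The joint law of the positions of independent particles started at the points of `γ`. -/
def positions {d : ℕ} (ν : Measure (E d)) (γ : Conf d) : Measure (γ.carrier → E d) :=
  Measure.infinitePi fun x : γ.carrier => ν.map ((x : E d) + ·)

instance {d : ℕ} (ν : Measure (E d)) [IsProbabilityMeasure ν] (γ : Conf d) :
    IsProbabilityMeasure (positions ν γ) := by
  unfold positions; infer_instance

/-- The law of the configuration of independent particles started at the points of `γ`. -/
def displacedLaw {d : ℕ} (ν : Measure (E d)) (γ : Conf d) : Measure (Conf d) :=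
  (positions ν γ).map fun w => setToConf (Set.range w)

/-- Realising the positions through `disp` lets the absence of collisions and the displacement of
finite subsets be read off one common probability space. -/
lemma positions_eq_map {d : ℕ} (ν : Measure (E d)) [IsProbabilityMeasure ν] (γ : Conf d) :
    positions ν γ = (disp ν).map fun z (x : γ.carrier) => (x : E d) + z x := by
  have h1 : (disp ν).map (fun z (x : γ.carrier) => z x) =
      Measure.infinitePi fun _ : γ.carrier => ν :=
    Measure.map_infinitePi_infinitePi_of_inj (P := fun _ : E d => ν) Subtype.val_injective
  have h2 := Measure.infinitePi_map_pi (μ := fun _ : γ.carrier => ν)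
    (f := fun x y => (x : E d) + y) fun x => measurable_const_add _
  rw [positions, ← h2, ← h1, Measure.map_map]
  · rfl
  · exact measurable_pi_lambda _ fun x => (measurable_pi_apply x).const_add _
  · exact measurable_pi_lambda _ fun x => measurable_pi_apply _

lemma measurable_addPos {d : ℕ} (γ : Conf d) :
    Measurable fun (z : E d → E d) (x : γ.carrier) => (x : E d) + z x :=
  measurable_pi_lambda _ fun x =>
    Measurable.const_add (f := fun z : E d → E d => z x) (measurable_pi_apply _) _

lemma setToConf_carrier {d : ℕ} {s : Set (E d)} (hs : ∀ n : ℕ,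
    (s ∩ Metric.closedBall 0 (n : ℝ)).Finite) : (setToConf s).carrier = s := by
  have h : ∀ S : Set (E d), IsCompact S → (s ∩ S).Finite := fun S hS => by
    obtain ⟨r, hr⟩ := hS.isBounded.subset_closedBall 0
    obtain ⟨n, hn⟩ := exists_nat_ge r
    exact (hs n).subset (Set.inter_subset_inter_right _
      (hr.trans (Metric.closedBall_subset_closedBall hn)))
  rw [setToConf, dif_pos h]

/-- The number of particles in a set, counted with multiplicities. -/
def occupation {d : ℕ} {α : Type*} (B : Set (E d)) (w : α → E d) : ℝ≥0∞ :=
  ∑' x, B.indicator 1 (w x)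

lemma measurable_occupation {d : ℕ} {α : Type*} [Countable α] {B : Set (E d)}
    (hB : MeasurableSet B) : Measurable (occupation B : (α → E d) → ℝ≥0∞) :=
  Measurable.tsum fun x => (measurable_one.indicator hB).comp (measurable_pi_apply x)

/-- The event that all the balls around the origin contain finitely many particles. -/
def DiscretePositions {d : ℕ} {α : Type*} (w : α → E d) : Prop :=
  ∀ n : ℕ, occupation (Metric.closedBall 0 (n : ℝ)) w ≠ ∞

lemma measurableSet_discretePositions (d : ℕ) (α : Type*) [Countable α] :
    MeasurableSet {w : α → E d | DiscretePositions w} := by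
  simp only [DiscretePositions, Set.ofPred_forall]
  exact MeasurableSet.iInter fun n =>
    (measurable_occupation Metric.isClosed_closedBall.measurableSet
      (measurableSet_singleton _)).compl

lemma DiscretePositions.carrier_eq {d : ℕ} {α : Type*} {w : α → E d} (hw : DiscretePositions w) :
    (setToConf (Set.range w)).carrier = Set.range w := by
  refine setToConf_carrier fun n => ?_
  have h := ENNReal.finite_const_le_of_tsum_ne_top (hw n) one_ne_zero
  refine (h.image w).subset ?_
  rintro _ ⟨⟨x, rfl⟩, hx⟩
  refine ⟨x, ?_, rfl⟩
  simp only [Set.mem_ofPred_eq]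
  rw [Set.indicator_of_mem hx]
  rfl

/-- The map is replaced by the empty configuration off the event `DiscretePositions`. On that event
the void condition only says that each of countably many particles avoids B. -/
lemma aemeasurable_setToConf {d : ℕ} {α : Type*} [Countable α] {P : Measure (α → E d)}
    (hP : ∀ᵐ w ∂P, DiscretePositions w) :
    AEMeasurable (fun w : α → E d => setToConf (Set.range w)) P := by
  classical
  refine ⟨fun w => if DiscretePositions w then setToConf (Set.range w) else setToConf ∅, ?_, ?_⟩
  · refine measurable_of_voidSet fun B hB => ?_
    have : (fun w : α → E d => if DiscretePositions w then setToConf (Set.range w)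
        else setToConf ∅) ⁻¹' voidSet B = {w | DiscretePositions w → ∀ x, w x ∈ Bᶜ} := by
      ext w
      simp only [Set.mem_preimage, voidSet, Set.mem_ofPred_eq]
      split_ifs with h
      · rw [h.carrier_eq, Set.disjoint_left]
        simp [h]
      · rw [setToConf_carrier (by simp)]
        simp [h]
    rw [this]
    refine (measurableSet_discretePositions d α).imp ?_
    rw [Set.ofPred_forall]
    exact MeasurableSet.iInter fun x => measurable_pi_apply x hB.compl
  · filter_upwards [hP] with w hw
    rw [if_pos hw]

/-- Configurations whose independently displaced points are a.s. locally finite in mean. -/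
def Dispersed {d : ℕ} (ν : Measure (E d)) (γ : Conf d) : Prop :=
  ∀ n : ℕ, ∫⁻ x, ν.map (x + ·) (Metric.closedBall 0 (n : ℝ)) ∂cnt γ ≠ ∞

lemma measurable_map_add_apply {d : ℕ} (ν : Measure (E d)) [SFinite ν] {B : Set (E d)}
    (hB : MeasurableSet B) : Measurable fun x => ν.map (x + ·) B := by
  have h : ∀ x : E d, ν.map (x + ·) B = ν (Prod.mk x ⁻¹' {p : E d × E d | p.1 + p.2 ∈ B}) :=
    fun x => by
      rw [Measure.map_apply (measurable_const_add x) hB]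
      rfl
  simp_rw [h]
  exact measurable_measure_prodMk_left ((measurable_fst.add measurable_snd) hB)

lemma measurableSet_dispersed {d : ℕ} (ν : Measure (E d)) [SFinite ν] :
    MeasurableSet {γ | Dispersed ν γ} := by
  simp only [Dispersed, Set.ofPred_forall]
  refine MeasurableSet.iInter fun n => ?_
  have hc : Measurable (cnt : Conf d → _) :=
    Measure.measurable_of_measurable_coe _ fun B hB => measurable_cnt hB
  have hB : MeasurableSet (Metric.closedBall (0 : E d) n) :=
    Metric.isClosed_closedBall.measurableSet
  exact (((Measure.measurable_lintegral (measurable_map_add_apply ν hB)).comp hc)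
    (measurableSet_singleton _)).compl

instance {d : ℕ} (γ : Conf d) : Countable γ.carrier := γ.countable.to_subtype

/-- The integral in `Dispersed` is the expected number of displaced particles in the ball; a finite
expectation forces almost sure finiteness. -/
lemma Dispersed.ae_discretePositions {d : ℕ} {ν : Measure (E d)} [IsProbabilityMeasure ν]
    {γ : Conf d} (hγ : Dispersed ν γ) : ∀ᵐ w ∂positions ν γ, DiscretePositions w := by
  refine ae_all_iff.2 fun n => ?_
  have hB : MeasurableSet (Metric.closedBall (0 : E d) n) :=
    Metric.isClosed_closedBall.measurableSet
  have h : ∫⁻ w, occupation (Metric.closedBall 0 (n : ℝ)) w ∂positions ν γ =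
      ∫⁻ x, ν.map (x + ·) (Metric.closedBall 0 (n : ℝ)) ∂cnt γ := by
    unfold occupation
    rw [lintegral_tsum, lintegral_cnt]
    · refine tsum_congr fun x => ?_
      have he : (positions ν γ).map (fun w => w x) = ν.map ((x : E d) + ·) :=
        Measure.infinitePi_map_eval _ x
      rw [← he, ← lintegral_indicator_one hB,
        lintegral_map (measurable_one.indicator hB) (measurable_pi_apply x)]
    · exact fun x =>
        ((measurable_one.indicator hB).comp (measurable_pi_apply x)).aemeasurable
  have hlt := ae_lt_top (measurable_occupation hB) (h.symm ▸ hγ n)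
  filter_upwards [hlt] with w hw using hw.ne

lemma Dispersed.aemeasurable {d : ℕ} {ν : Measure (E d)} [IsProbabilityMeasure ν]
    {γ : Conf d} (hγ : Dispersed ν γ) :
    AEMeasurable (fun w => setToConf (Set.range w)) (positions ν γ) :=
  aemeasurable_setToConf hγ.ae_discretePositions

lemma Dispersed.isProbabilityMeasure {d : ℕ} {ν : Measure (E d)} [IsProbabilityMeasure ν]
    {γ : Conf d} (hγ : Dispersed ν γ) : IsProbabilityMeasure (displacedLaw ν γ) :=
  Measure.isProbabilityMeasure_map hγ.aemeasurable

lemma ae_positions_injective {d : ℕ} {ν : Measure (E d)} [IsProbabilityMeasure ν]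
    (hν : ∀ v, v ≠ 0 → ν {v} = 0) (γ : Conf d) :
    ∀ᵐ w ∂positions ν γ, Function.Injective w := by
  rw [positions_eq_map, ae_map_iff (measurable_addPos γ).aemeasurable
    (measurableSet_injective d _)]
  filter_upwards [ae_injOn hν γ.countable] with z hz x y hxy
  exact Subtype.ext (hz x.2 y.2 hxy)

/-- The displaced configuration acts on observables through the displacement of finite
configurations. -/
lemma Dispersed.lintegral_KTransform {d : ℕ} {ν : Measure (E d)} [IsProbabilityMeasure ν]
    (hν : ∀ v, v ≠ 0 → ν {v} = 0) {γ : Conf d} (hγ : Dispersed ν γ) {H : FinConf d → ℝ≥0∞}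
    (hH : Measurable H) :
    ∫⁻ γ', KTransform H γ' ∂displacedLaw ν γ = KTransform (levolved ν H) γ := by
  classical
  have hm : ∀ F : Finset γ.carrier,
      Measurable fun w : γ.carrier → E d => (⟨F.image w⟩ : FinConf d) := fun F => by
    refine measurable_finConf_of_void fun B hB => ?_
    have : {w : γ.carrier → E d | ∀ y ∈ F.image w, y ∉ B} = ⋂ x ∈ F, {w | w x ∈ Bᶜ} := by
      ext w
      rw [Set.mem_iInter₂]
      exact Finset.forall_mem_image
    change MeasurableSet {w : γ.carrier → E d | ∀ y ∈ F.image w, y ∉ B}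
    rw [this]
    exact Finset.measurableSet_biInter _ fun x _ => measurable_pi_apply x hB.compl
  rw [displacedLaw, lintegral_map' (measurable_KTransform hH).aemeasurable hγ.aemeasurable]
  calc ∫⁻ w, KTransform H (setToConf (Set.range w)) ∂positions ν γ
      = ∫⁻ w, ∑' F : Finset γ.carrier, H ⟨F.image w⟩ ∂positions ν γ := by
        refine lintegral_congr_ae ?_
        filter_upwards [hγ.ae_discretePositions, ae_positions_injective hν γ] with w hw hi
        -- Absence of collisions makes w an injective enumeration of the new configuration, so
        -- finite sets of particles correspond to finite subsets of it.
        rw [KTransform_eq_tsum_finset hi hw.carrier_eq.symm]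
    _ = ∑' F : Finset γ.carrier, ∫⁻ w, H ⟨F.image w⟩ ∂positions ν γ :=
        lintegral_tsum fun F => (hH.comp (hm F)).aemeasurable
    _ = ∑' F : Finset γ.carrier, levolved ν H ⟨F.image Subtype.val⟩ := by
        refine tsum_congr fun F => ?_
        rw [positions_eq_map,
          lintegral_map (f := fun w => H ⟨F.image w⟩) (hH.comp (hm F)) (measurable_addPos γ),
          levolved]
        refine lintegral_congr fun z => ?_
        congr 1
        ext y
        simp [mem_moved]
    _ = KTransform (levolved ν H) γ :=
        (KTransform_eq_tsum_finset Subtype.val_injective Subtype.range_coe _).symm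

/-- By independence the void probability is the product of the probabilities that the single
particles miss B. The factors are at most one, so the infinite product is the infimum of the finite
ones, a form that is measurable in γ. -/
lemma Dispersed.displacedLaw_voidSet {d : ℕ} {ν : Measure (E d)} [IsProbabilityMeasure ν]
    {γ : Conf d} (hγ : Dispersed ν γ) {B : Set (E d)} (hB : MeasurableSet B) :
    displacedLaw ν γ (voidSet B) =
      ⨅ η : {η : FinConf d // (η.pts : Set (E d)) ⊆ γ.carrier},
        ∏ x ∈ η.1.pts, ν.map (x + ·) Bᶜ := by
  classical
  have h1 : (fun w : γ.carrier → E d => setToConf (Set.range w)) ⁻¹' voidSet B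
      =ᵐ[positions ν γ] Set.univ.pi fun _ => Bᶜ := by
    filter_upwards [hγ.ae_discretePositions] with w hw
    refine propext ?_
    change Disjoint (setToConf (Set.range w)).carrier B ↔ w ∈ Set.univ.pi fun _ => Bᶜ
    rw [hw.carrier_eq, Set.disjoint_left, Set.forall_mem_range, Set.mem_univ_pi]
    rfl
  rw [displacedLaw, Measure.map_apply_of_aemeasurable hγ.aemeasurable (measurableSet_voidSet hB),
    measure_congr h1, positions, Measure.infinitePi_pi_univ _ fun _ => hB.compl,
    ENNReal.tprod_eq_iInf_prod fun _ => prob_le_one,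
    ← (finsetEquiv Subtype.val_injective Subtype.range_coe).iInf_comp]
  refine iInf_congr fun F => ?_
  rw [finsetEquiv_apply]
  dsimp only
  rw [Finset.prod_image Subtype.val_injective.injOn]

lemma measurable_prod_pts {d : ℕ} {q : E d → ℝ≥0∞} (hq : Measurable q) :
    Measurable fun η : FinConf d => ∏ x ∈ η.pts, q x := by
  classical
  refine measurable_finConf fun n => ?_
  have h : ∀ x : {x : Fin n → E d // Function.Injective x},
      ∏ y ∈ (tupleConf x.1).pts, q y = ∏ i, q (x.1 i) := fun x => by
    rw [tupleConf, Finset.prod_image x.2.injOn]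
  simp_rw [h]
  exact Finset.measurable_fun_prod _ fun i _ =>
    hq.comp ((measurable_pi_apply i).comp measurable_subtype_coe)

lemma aemeasurable_displacedLaw {d : ℕ} {ν : Measure (E d)} [IsProbabilityMeasure ν]
    {μ : Measure (Conf d)} (hμ : ∀ᵐ γ ∂μ, Dispersed ν γ) : AEMeasurable (displacedLaw ν) μ := by
  classical
  -- The Dirac mass is an arbitrary filler: the π-system criterion needs a probability measure at
  -- every γ, including those that are not dispersed.
  let F : Conf d → Measure (Conf d) := fun γ =>
    if Dispersed ν γ then displacedLaw ν γ else Measure.dirac (setToConf ∅)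
  have hF : ∀ γ, IsProbabilityMeasure (F γ) := fun γ => by
    by_cases h : Dispersed ν γ
    · simp only [F, if_pos h]
      exact h.isProbabilityMeasure
    · simp only [F, if_neg h]
      infer_instance
  refine ⟨F, ?_, ?_⟩
  · refine Measurable.measure_of_isPiSystem_of_isProbabilityMeasure (generateFrom_voidSet d)
      (isPiSystem_voidSet d) ?_
    rintro _ ⟨B, hB, rfl⟩
    have h : ∀ γ, F γ (voidSet B) = if Dispersed ν γ then
        ⨅ η : {η : FinConf d // (η.pts : Set (E d)) ⊆ γ.carrier},
          ∏ x ∈ η.1.pts, ν.map (x + ·) Bᶜ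
        else Measure.dirac (setToConf ∅) (voidSet B) := fun γ => by
      by_cases h : Dispersed ν γ
      · simp only [F, if_pos h]
        exact h.displacedLaw_voidSet hB
      · simp only [F, if_neg h]
    simp_rw [h]
    exact Measurable.ite (measurableSet_dispersed ν)
      (measurable_iInf_finConf (measurable_prod_pts (measurable_map_add_apply ν hB.compl)))
      measurable_const
  · filter_upwards [hμ] with γ hγ
    simp only [F, if_pos hγ]

/-! ### One-point correlations -/

lemma lintegral_pi_fin_one {d : ℕ} (m : Measure (E d)) [SigmaFinite m] (f : E d → ℝ≥0∞) :
    ∫⁻ x in {x : Fin 1 → E d | Function.Injective x}, f (x 0) ∂(Measure.pi fun _ => m) =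
      ∫⁻ x, f x ∂m := by
  have h : {x : Fin 1 → E d | Function.Injective x} = Set.univ :=
    Set.eq_univ_of_forall fun x => Function.injective_of_subsingleton x
  rw [h, Measure.restrict_univ]
  exact (measurePreserving_funUnique m (Fin 1)).lintegral_comp_emb
    (MeasurableEquiv.measurableEmbedding _) f

/-- This is Campbell's formula for constant intensity: the correlation identity tested on a
functional that lives on one-point configurations. -/
lemma lintegral_lintegral_cnt {d : ℕ} {μ : Measure (Conf d)} {k : FinConf d → ℝ}
    (hk : IsCorrelationFunctional μ k) {c : ℝ} (hc : ∀ x, k (FinConf.single x) = c)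
    {f : E d → ℝ≥0∞} (hf : Measurable f) :
    ∫⁻ γ, ∫⁻ x, f x ∂cnt γ ∂μ = ENNReal.ofReal c * ∫⁻ x, f x := by
  classical
  let H : FinConf d → ℝ≥0∞ := fun η => if η.pts.card = 1 then ∏ x ∈ η.pts, f x else 0
  have hH : Measurable H :=
    Measurable.ite (measurableSet_card_eq d 1) (measurable_prod_pts hf) measurable_const
  have hH0 : ∀ n, n ≠ 1 → ∀ x : Fin n → E d, Function.Injective x → H (tupleConf x) = 0 :=
    fun n hn x hx => by
      simp only [H]
      rw [if_neg]
      rw [tupleConf_eq_img, card_img hx, Fintype.card_fin]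
      exact hn
  have hsingle : ∀ x : Fin 1 → E d, tupleConf x = FinConf.single (x 0) := fun x => by
    ext y
    simp [tupleConf_eq_img, mem_img, FinConf.single, eq_comm]
  have hH1 : ∀ x : Fin 1 → E d, H (tupleConf x) = f (x 0) := fun x => by
    rw [hsingle]
    simp [H, FinConf.single]
  have hK : ∀ γ, KTransform H γ = ∫⁻ x, f x ∂cnt γ := fun γ => by
    rw [KTransform_eq_tsum, tsum_eq_single 1]
    · simp_rw [hH1]
      rw [cntPi, lintegral_pi_fin_one]
      simp
    · intro n hn
      rw [setLIntegral_congr_fun (measurableSet_injective d _) (g := 0) fun x hx => hH0 n hn x hx]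
      simp
  have h := hk.density H hH
  simp_rw [hK] at h
  rw [h, lintegral_withDensity_eq_lintegral_mul _ hk.measurable.ennreal_ofReal hH,
    lintegral_lebesguePoisson (hk.measurable.ennreal_ofReal.mul hH), tsum_eq_single 1]
  · have h1 : ∀ x : Fin 1 → E d, ((fun η => ENNReal.ofReal (k η)) * H) (tupleConf x) =
        ENNReal.ofReal c * f (x 0) := fun x => by
      rw [Pi.mul_apply, hH1, hsingle, hc]
    simp_rw [h1]
    rw [volume_pi, lintegral_pi_fin_one (volume : Measure (E d)) (fun x => ENNReal.ofReal c * f x),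
      lintegral_const_mul _ hf]
    simp
  · intro n hn
    rw [setLIntegral_congr_fun (measurableSet_injective d _) (g := 0) fun x hx => by
      rw [Pi.mul_apply, hH0 n hn x hx, mul_zero]; rfl]
    simp

/-- By Tonelli and translation invariance, ∫ ν(B - x) dx = vol(B) for a ball B. Campbell's formula
makes the mean of the expected occupation of B a finite multiple of vol(B), so that occupation is
almost surely finite. -/
lemma ae_dispersed {d : ℕ} {μ : Measure (Conf d)} {k : FinConf d → ℝ}
    (hk : IsCorrelationFunctional μ k) {c : ℝ} (hc : ∀ x, k (FinConf.single x) = c)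
    (ν : Measure (E d)) [IsProbabilityMeasure ν] : ∀ᵐ γ ∂μ, Dispersed ν γ := by
  refine ae_all_iff.2 fun n => ?_
  have hB : MeasurableSet (Metric.closedBall (0 : E d) n) :=
    Metric.isClosed_closedBall.measurableSet
  have hm := measurable_map_add_apply ν hB
  have hvol : ∫⁻ x, ν.map (x + ·) (Metric.closedBall (0 : E d) n) =
      volume (Metric.closedBall (0 : E d) n) := by
    have h : ∀ x : E d, ν.map (x + ·) (Metric.closedBall (0 : E d) n) =
        ∫⁻ z, (Metric.closedBall (0 : E d) n).indicator 1 (x + z) ∂ν := fun x => by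
      rw [← lintegral_indicator_one hB,
        lintegral_map (measurable_one.indicator hB) (measurable_const_add x)]
    simp_rw [h]
    rw [lintegral_lintegral_swap]
    · have h2 : ∀ z : E d, ∫⁻ x, (Metric.closedBall (0 : E d) n).indicator 1 (x + z) =
          volume (Metric.closedBall (0 : E d) n) := fun z => by
        rw [lintegral_add_right_eq_self (fun x => (Metric.closedBall (0 : E d) n).indicator
          (1 : E d → ℝ≥0∞) x) z, lintegral_indicator_one hB]
      simp_rw [h2]
      simp
    · exact ((measurable_one.indicator hB).comp (measurable_fst.add measurable_snd)).aemeasurable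
  have h := lintegral_lintegral_cnt hk hc hm
  have hfin : ∫⁻ γ, ∫⁻ x, ν.map (x + ·) (Metric.closedBall (0 : E d) n) ∂cnt γ ∂μ ≠ ∞ := by
    rw [h, hvol]
    exact ENNReal.mul_ne_top ENNReal.ofReal_ne_top measure_closedBall_lt_top.ne
  have hc : Measurable (cnt : Conf d → _) :=
    Measure.measurable_of_measurable_coe _ fun B hB => measurable_cnt hB
  filter_upwards [ae_lt_top ((Measure.measurable_lintegral hm).comp hc) hfin] with γ hγ
  exact hγ.ne

/-! ### Partitions of the image of a finite set -/

section Partition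
lemma image_filter_mem {α β : Type*} [DecidableEq β] {s : Finset α} {f : α → β}
    {B : Finset β} (hB : B ⊆ s.image f) : (s.filter (f · ∈ B)).image f = B := by
  ext y
  simp only [Finset.mem_image, Finset.mem_filter]
  constructor
  · rintro ⟨x, ⟨-, hx⟩, rfl⟩
    exact hx
  · intro hy
    obtain ⟨x, hx, rfl⟩ := Finset.mem_image.1 (hB hy)
    exact ⟨x, ⟨hx, hy⟩, rfl⟩

lemma filter_mem_image {α β : Type*} [DecidableEq β] {s : Finset α} {f : α → β}
    (hf : Set.InjOn f s) {B : Finset α} (hB : B ⊆ s) :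
    s.filter (f · ∈ B.image f) = B := by
  ext x
  simp only [Finset.mem_image, Finset.mem_filter]
  constructor
  · rintro ⟨hx, y, hy, hyx⟩
    exact hf (hB hy) hx hyx ▸ hy
  · exact fun hx => ⟨hB hx, x, hx, rfl⟩

variable {α β : Type*} [DecidableEq α] [DecidableEq β] {s : Finset α} {f : α → β}

/-- The partitions of a finite set and those of its image under an injective map correspond. -/
def partitionImageEquiv (hf : Set.InjOn f s) : Finpartition s ≃ Finpartition (s.image f) where
  toFun π :=
    { parts := π.parts.image (Finset.image f)
      supIndep := by
        rw [Finset.supIndep_iff_pairwiseDisjoint]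
        intro B hB C hC hne
        simp only [Finset.coe_image, Set.mem_image] at hB hC
        obtain ⟨B, hB, rfl⟩ := hB
        obtain ⟨C, hC, rfl⟩ := hC
        have hBC : Disjoint B C := π.disjoint hB hC fun h => hne (h ▸ rfl)
        rw [Function.onFun, id, id, Finset.disjoint_left]
        intro y hyB hyC
        obtain ⟨x, hx, rfl⟩ := Finset.mem_image.1 hyB
        obtain ⟨x', hx', hxx'⟩ := Finset.mem_image.1 hyC
        exact Finset.disjoint_left.1 hBC hx
          (hf (π.le hC hx') (π.le hB hx) hxx' ▸ hx')
      sup_parts := by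
        ext y
        simp only [Finset.mem_sup, Finset.mem_image, id]
        constructor
        · rintro ⟨_, ⟨B, hB, rfl⟩, hy⟩
          obtain ⟨x, hx, rfl⟩ := Finset.mem_image.1 hy
          exact ⟨x, π.le hB hx, rfl⟩
        · rintro ⟨x, hx, rfl⟩
          obtain ⟨B, hB, hxB⟩ := π.exists_mem hx
          exact ⟨_, ⟨B, hB, rfl⟩, Finset.mem_image_of_mem f hxB⟩
      bot_notMem := by
        simp only [Finset.bot_eq_empty, Finset.mem_image, Finset.image_eq_empty, not_exists,
          not_and]
        rintro B hB rfl
        exact π.bot_notMem hB }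
  invFun π :=
    { parts := π.parts.image fun B => s.filter (f · ∈ B)
      supIndep := by
        rw [Finset.supIndep_iff_pairwiseDisjoint]
        intro B hB C hC hne
        simp only [Finset.coe_image, Set.mem_image] at hB hC
        obtain ⟨B, hB, rfl⟩ := hB
        obtain ⟨C, hC, rfl⟩ := hC
        have hBC : Disjoint B C := π.disjoint hB hC fun h => hne (h ▸ rfl)
        rw [Function.onFun, id, id, Finset.disjoint_left]
        intro x hxB hxC
        exact Finset.disjoint_left.1 hBC (Finset.mem_filter.1 hxB).2 (Finset.mem_filter.1 hxC).2
      sup_parts := by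
        ext x
        simp only [Finset.mem_sup, Finset.mem_image, id]
        constructor
        · rintro ⟨_, ⟨B, hB, rfl⟩, hx⟩
          exact (Finset.mem_filter.1 hx).1
        · intro hx
          obtain ⟨B, hB, hxB⟩ := π.exists_mem (Finset.mem_image_of_mem f hx)
          exact ⟨_, ⟨B, hB, rfl⟩, Finset.mem_filter.2 ⟨hx, hxB⟩⟩
      bot_notMem := by
        simp only [Finset.bot_eq_empty, Finset.mem_image, not_exists, not_and]
        intro B hB h
        have := image_filter_mem (π.le hB)
        rw [h, Finset.image_empty] at this
        subst this
        exact π.bot_notMem hB }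
  left_inv π := by
    ext1
    dsimp only
    rw [Finset.image_image, Finset.image_congr (g := id), Finset.image_id]
    exact fun B hB => filter_mem_image hf (π.le hB)
  right_inv π := by
    ext1
    dsimp only
    rw [Finset.image_image, Finset.image_congr (g := id), Finset.image_id]
    exact fun B hB => image_filter_mem (π.le hB)

lemma sum_finpartition_image {M : Type*} [CommSemiring M] (hf : Set.InjOn f s) (g : Finset β → M) :
    ∑ π : Finpartition (s.image f), ∏ B ∈ π.parts, g B =
      ∑ π : Finpartition s, ∏ B ∈ π.parts, g (B.image f) := by
  rw [← (partitionImageEquiv hf).sum_comp]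
  refine Finset.sum_congr rfl fun π _ => ?_
  change ∏ B ∈ π.parts.image (Finset.image f), g B = _
  rw [Finset.prod_image]
  intro B hB C hC h
  rw [← filter_mem_image hf (π.le hB), ← filter_mem_image hf (π.le hC)]
  rw [h]

/-- This is what makes the Ursell relation a recursion: apart from the one-block partition, only
strictly smaller blocks occur. -/
lemma ssubset_of_mem_parts_of_ne {hs : s ≠ ⊥} {π : Finpartition s}
    (hπ : π ≠ Finpartition.indiscrete hs) {B : Finset α} (hB : B ∈ π.parts) : B ⊂ s := by
  refine (π.le hB).lt_of_ne ?_
  rintro rfl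
  refine hπ ?_
  ext1
  rw [Finpartition.indiscrete_parts]
  refine Finset.eq_singleton_iff_unique_mem.2 ⟨hB, fun C hC => ?_⟩
  by_contra hne
  have h := π.disjoint hC hB hne
  have h2 : C = ⊥ := disjoint_self.1 (h.mono_right (π.le hC))
  exact π.bot_notMem (h2 ▸ hC)

end Partition

/-! ### The Ursell functional of a correlation functional -/

open scoped Classical in
-- Isolating the one-block partition expresses u on n points through k and the values of u on fewer
-- points. Partitions are indexed by `Fin n`, so the sum does not depend on x.
lemma IsUrsell.eq_sub {d : ℕ} {k u : FinConf d → ℝ} (hu : IsUrsell k u) {n : ℕ} (hn : n ≠ 0)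
    {x : Fin n → E d} (hx : Function.Injective x) :
    ∃ h : (Finset.univ : Finset (Fin n)) ≠ ⊥, u (tupleConf x) = k (tupleConf x) -
      ∑ π ∈ (Finset.univ : Finset (Finpartition (Finset.univ : Finset (Fin n)))).erase
        (Finpartition.indiscrete h), ∏ B ∈ π.parts, u ⟨B.image x⟩ := by
  have : NeZero n := ⟨hn⟩
  have h : (Finset.univ : Finset (Fin n)) ≠ ⊥ := Finset.univ_nonempty.ne_empty
  refine ⟨h, ?_⟩
  have h1 := hu (tupleConf x)
  have h2 : ∑ π : Finpartition (tupleConf x).pts, ∏ B ∈ π.parts, u ⟨B⟩ =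
      ∑ π : Finpartition (Finset.univ : Finset (Fin n)), ∏ B ∈ π.parts, u ⟨B.image x⟩ :=
    sum_finpartition_image (s := Finset.univ) hx.injOn fun B => u ⟨B⟩
  rw [h2, ← Finset.add_sum_erase _ _ (Finset.mem_univ (Finpartition.indiscrete h)),
    Finpartition.indiscrete_parts, Finset.prod_singleton] at h1
  rw [h1]
  exact (add_sub_cancel_right _ _).symm

open scoped Classical in
lemma image_eq_tupleConf {d n : ℕ} (x : Fin n → E d) (B : Finset (Fin n)) :
    (⟨B.image x⟩ : FinConf d) = tupleConf (x ∘ B.orderEmbOfFin rfl) := by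
  ext y
  rw [tupleConf_eq_img, mem_img, Finset.mem_image]
  constructor
  · rintro ⟨i, hi, rfl⟩
    have : i ∈ Set.range (B.orderEmbOfFin rfl) := by
      rw [Finset.range_orderEmbOfFin]
      exact hi
    obtain ⟨j, rfl⟩ := this
    exact ⟨j, rfl⟩
  · rintro ⟨j, rfl⟩
    exact ⟨_, Finset.orderEmbOfFin_mem B rfl j, rfl⟩

lemma card_lt_of_mem_erase {n : ℕ} {h : (Finset.univ : Finset (Fin n)) ≠ ⊥}
    {π : Finpartition (Finset.univ : Finset (Fin n))} (hπ : π ≠ Finpartition.indiscrete h)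
    {B : Finset (Fin n)} (hB : B ∈ π.parts) : B.card < n := by
  simpa using Finset.card_lt_card (ssubset_of_mem_parts_of_ne hπ hB)

lemma IsUrsell.measurable {d : ℕ} {k u : FinConf d → ℝ} (hu : IsUrsell k u) (hk : Measurable k) :
    Measurable u := by
  classical
  refine measurable_finConf fun n => ?_
  induction n using Nat.strong_induction_on with
  | _ n ih =>
    rcases eq_or_ne n 0 with rfl | hn
    · exact Subsingleton.measurable
    · have : NeZero n := ⟨hn⟩
      have h : (Finset.univ : Finset (Fin n)) ≠ ⊥ := Finset.univ_nonempty.ne_empty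
      have heq : ∀ x : {x : Fin n → E d // Function.Injective x}, u (tupleConf x.1) =
          k (tupleConf x.1) -
          ∑ π ∈ (Finset.univ : Finset (Finpartition (Finset.univ : Finset (Fin n)))).erase
            (Finpartition.indiscrete h), ∏ B ∈ π.parts,
              u (tupleConf (x.1 ∘ B.orderEmbOfFin rfl)) := fun x => by
        obtain ⟨_, hx⟩ := hu.eq_sub hn x.2
        rw [hx]
        simp_rw [image_eq_tupleConf]
      simp_rw [heq]
      refine (hk.comp (measurable_tupleConf.comp measurable_subtype_coe)).sub ?_
      refine Finset.measurable_fun_sum _ fun π hπ => Finset.measurable_fun_prod _ fun B hB => ?_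
      have hlt := card_lt_of_mem_erase (Finset.ne_of_mem_erase hπ) hB
      have hsub : Measurable (fun x : {x : Fin n → E d // Function.Injective x} =>
        (⟨x.1 ∘ B.orderEmbOfFin rfl, x.2.comp (B.orderEmbOfFin rfl).injective⟩ :
          {x : Fin B.card → E d // Function.Injective x})) := by
        refine Measurable.subtype_mk (measurable_pi_lambda _ fun i => ?_)
        exact (measurable_pi_apply (B.orderEmbOfFin rfl i)).comp measurable_subtype_coe
      exact (ih _ hlt).comp hsub

/-- A displaced configuration may lose points through collisions, so the bound is needed in a form
monotone in the number of points. -/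
lemma GrowthBound.exists_le {d : ℕ} {k : FinConf d → ℝ} (hk : GrowthBound k) :
    ∃ s C : ℝ, 0 ≤ s ∧ s < 1 ∧ 0 < C ∧ ∀ (n : ℕ) (η : FinConf d), η.pts.card ≤ n →
      k η ≤ (n.factorial : ℝ) ^ s * C ^ n := by
  obtain ⟨s, C, hs, hs1, hC, h⟩ := hk
  -- Enlarging C to at least 1 makes the power non-decreasing in n.
  refine ⟨s, max C 1, hs, hs1, by positivity, fun n η hη => (h η).trans ?_⟩
  refine mul_le_mul ?_ ?_ (by positivity) (by positivity)
  · exact Real.rpow_le_rpow (by positivity) (by exact_mod_cast Nat.factorial_le hη) hs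
  · exact (pow_le_pow_left₀ hC.le (le_max_left C 1) _).trans
      (pow_le_pow_right₀ (le_max_right C 1) hη)

/-- Boundedness on n points follows by strong induction along the recursion; the constant may depend
on n, which is enough for dominated convergence. -/
lemma IsUrsell.exists_abs_le {d : ℕ} {k u : FinConf d → ℝ} (hu : IsUrsell k u)
    (hk0 : ∀ η, 0 ≤ k η) (hk : GrowthBound k) (n : ℕ) :
    ∃ M, ∀ x : Fin n → E d, Function.Injective x → |u (tupleConf x)| ≤ M := by
  classical
  induction n using Nat.strong_induction_on with
  | _ n ih =>
    rcases eq_or_ne n 0 with rfl | hn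
    · exact ⟨|u (tupleConf 0)|, fun x _ => by rw [Subsingleton.elim x 0]⟩
    · have : NeZero n := ⟨hn⟩
      have h : (Finset.univ : Finset (Fin n)) ≠ ⊥ := Finset.univ_nonempty.ne_empty
      obtain ⟨s, C, -, -, -, hkb⟩ := hk.exists_le
      choose! M hM using ih
      refine ⟨(n.factorial : ℝ) ^ s * C ^ n +
        ∑ π ∈ (Finset.univ : Finset (Finpartition (Finset.univ : Finset (Fin n)))).erase
            (Finpartition.indiscrete h), ∏ B ∈ π.parts, M B.card, fun x hx => ?_⟩
      obtain ⟨_, hux⟩ := hu.eq_sub hn hx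
      rw [hux]
      refine (abs_sub _ _).trans (add_le_add ?_ ?_)
      · rw [abs_of_nonneg (hk0 _)]
        refine hkb n _ ?_
        rw [tupleConf_eq_img]
        exact (card_img_le x).trans_eq (Fintype.card_fin n)
      · refine (Finset.abs_sum_le_sum_abs _ _).trans (Finset.sum_le_sum fun π hπ => ?_)
        rw [Finset.abs_prod]
        refine Finset.prod_le_prod (fun _ _ => abs_nonneg _) fun B hB => ?_
        rw [image_eq_tupleConf]
        exact hM _ (card_lt_of_mem_erase (Finset.ne_of_mem_erase hπ) hB) _
          (hx.comp (B.orderEmbOfFin rfl).injective)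

lemma IsUrsell.exists_abs_le_of_card_le {d : ℕ} {k u : FinConf d → ℝ} (hu : IsUrsell k u)
    (hk0 : ∀ η, 0 ≤ k η) (hk : GrowthBound k) (n : ℕ) :
    ∃ M, ∀ η : FinConf d, η.pts.card ≤ n → |u η| ≤ M := by
  choose M hM using hu.exists_abs_le hk0 hk
  refine ⟨∑ m ∈ Finset.range (n + 1), |M m|, fun η hη => ?_⟩
  obtain ⟨x, hx, hxη⟩ := exists_tupleConf_eq η
  have h := hM _ x hx
  rw [hxη] at h
  refine (h.trans (le_abs_self _)).trans ?_
  exact Finset.single_le_sum (f := fun m => |M m|) (fun m _ => abs_nonneg _)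
    (Finset.mem_range.2 (Nat.lt_succ_of_le hη))

lemma card_moved_le {d : ℕ} (z : E d → E d) (η : FinConf d) :
    (moved z η).pts.card ≤ η.pts.card := Finset.card_image_le

/-! ### Evolution of the Ursell functional -/

lemma moved_congr {d : ℕ} {z z' : E d → E d} {η : FinConf d} (h : ∀ x ∈ η.pts, z x = z' x) :
    moved z η = moved z' η := by
  ext y
  rw [mem_moved, mem_moved]
  constructor
  · rintro ⟨x, hx, rfl⟩
    exact ⟨x, hx, by rw [h x hx]⟩
  · rintro ⟨x, hx, rfl⟩
    exact ⟨x, hx, by rw [h x hx]⟩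

/-- Disjoint blocks use disjoint sets of displacement coordinates, which are independent, so the
expectation factorises one block at a time. -/
lemma integral_prod_moved {d : ℕ} (ν : Measure (E d)) [IsProbabilityMeasure ν]
    {u : FinConf d → ℝ} (hu : Measurable u) (P : Finset (Finset (E d)))
    (hP : (P : Set (Finset (E d))).PairwiseDisjoint id) :
    ∫ z, ∏ B ∈ P, u (moved z ⟨B⟩) ∂disp ν = ∏ B ∈ P, evolved ν u ⟨B⟩ := by
  classical
  induction P using Finset.induction_on with
  | empty => simp
  | insert B P hB ih =>
    rw [Finset.coe_insert, Set.pairwiseDisjoint_insert_of_notMem (by simpa using hB)] at hP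
    simp_rw [Finset.prod_insert hB]
    rw [← ih hP.1]
    let T : Finset (E d) := P.biUnion id
    have hd : Disjoint B T := by
      rw [Finset.disjoint_biUnion_right]
      exact fun C hC => hP.2 C hC
    -- Extension by zero exhibits each factor as a measurable function of the displacements of its
    -- own points; the filler is never read.
    let ext : (S : Finset (E d)) → (S → E d) → E d → E d :=
      fun S w x => if h : x ∈ S then w ⟨x, h⟩ else 0
    have hext : ∀ S, Measurable (ext S) := fun S => measurable_pi_lambda _ fun x => by
      by_cases h : x ∈ S
      · simp only [ext, dif_pos h]
        exact measurable_pi_apply _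
      · simp only [ext, dif_neg h]
        exact measurable_const
    have hind : ProbabilityTheory.iIndepFun (fun x (z : E d → E d) => z x) (disp ν) :=
      ProbabilityTheory.iIndepFun_infinitePi (P := fun _ : E d => ν) (X := fun _ w => w)
        fun _ => measurable_id
    have h1 := hind.indepFun_finset B T hd fun x => measurable_pi_apply x
    have hmv : ∀ η : FinConf d, Measurable fun z => u (moved z η) := fun η =>
      hu.comp (measurable_moved η)
    have hφ : Measurable fun w : B → E d => u (moved (ext B w) ⟨B⟩) := (hmv _).comp (hext B)
    have hψ : Measurable fun w : T → E d => ∏ C ∈ P, u (moved (ext T w) ⟨C⟩) :=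
      Finset.measurable_fun_prod _ fun C _ => (hmv _).comp (hext T)
    have h2 := h1.comp hφ hψ
    have e1 : (fun w : B → E d => u (moved (ext B w) ⟨B⟩)) ∘ (fun (z : E d → E d) (i : B) => z i) =
        fun z => u (moved z ⟨B⟩) := by
      funext z
      simp only [Function.comp]
      congr 1
      refine moved_congr fun x hx => ?_
      simp only [ext]
      rw [dif_pos hx]
    have e2 : (fun w : T → E d => ∏ C ∈ P, u (moved (ext T w) ⟨C⟩)) ∘
        (fun (z : E d → E d) (i : T) => z i) = fun z => ∏ C ∈ P, u (moved z ⟨C⟩) := by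
      funext z
      simp only [Function.comp]
      refine Finset.prod_congr rfl fun C hC => ?_
      congr 1
      refine moved_congr fun x hx => ?_
      have : x ∈ T := Finset.mem_biUnion.2 ⟨C, hC, hx⟩
      simp only [ext]
      rw [dif_pos this]
    rw [e1, e2] at h2
    exact h2.integral_fun_mul_eq_mul_integral (hmv _).aestronglyMeasurable
      (Finset.measurable_fun_prod _ fun C _ => hmv _).aestronglyMeasurable

/-- Almost surely the displacement is injective on η, so partitions of the displaced configuration
are displaced partitions of η. Taking expectations in the partition formula then factorises every
product over blocks. -/
lemma isUrsell_evolved {d : ℕ} {k u : FinConf d → ℝ} (hu : IsUrsell k u) (hkm : Measurable k)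
    (hk0 : ∀ η, 0 ≤ k η) (hk : GrowthBound k) {ν : Measure (E d)} [IsProbabilityMeasure ν]
    (hν : ∀ v, v ≠ 0 → ν {v} = 0) : IsUrsell (evolved ν k) (evolved ν u) := by
  classical
  intro η
  have hum := hu.measurable hkm
  have h1 : evolved ν k η =
      ∫ z, ∑ π : Finpartition η.pts, ∏ B ∈ π.parts, u (moved z ⟨B⟩) ∂disp ν := by
    refine integral_congr_ae ?_
    filter_upwards [ae_injOn hν η.pts.countable_toSet] with z hz
    rw [hu]
    have := sum_finpartition_image (s := η.pts) (f := fun x => x + z x) hz fun B => u ⟨B⟩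
    unfold moved
    convert! this
  have hint : ∀ π : Finpartition η.pts,
      Integrable (fun z => ∏ B ∈ π.parts, u (moved z ⟨B⟩)) (disp ν) := fun π => by
    choose M hM using hu.exists_abs_le_of_card_le hk0 hk
    refine Integrable.of_bound (Finset.measurable_fun_prod _ fun B _ =>
      hum.comp (measurable_moved _)).aestronglyMeasurable (∏ B ∈ π.parts, M B.card)
      (.of_forall fun z => ?_)
    rw [Real.norm_eq_abs, Finset.abs_prod]
    exact Finset.prod_le_prod (fun _ _ => abs_nonneg _) fun B hB => hM _ _ (card_moved_le z ⟨B⟩)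
  rw [h1, integral_finsetSum _ fun π _ => hint π]
  refine Finset.sum_congr rfl fun π _ => ?_
  refine integral_prod_moved ν hum π.parts ?_
  exact π.disjoint

/-! ### The evolution preserves the conditions on the correlation functional -/

lemma evolved_nonneg {d : ℕ} (ν : Measure (E d)) {k : FinConf d → ℝ} (hk0 : ∀ η, 0 ≤ k η)
    (η : FinConf d) : 0 ≤ evolved ν k η := integral_nonneg fun _ => hk0 _

lemma integrable_moved {d : ℕ} (ν : Measure (E d)) [IsProbabilityMeasure ν] {k : FinConf d → ℝ}
    (hkm : Measurable k) (hk0 : ∀ η, 0 ≤ k η) (hk : GrowthBound k) (η : FinConf d) :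
    Integrable (fun z => k (moved z η)) (disp ν) := by
  obtain ⟨s, C, -, -, -, h⟩ := hk.exists_le
  refine Integrable.of_bound (hkm.comp (measurable_moved η)).aestronglyMeasurable
    ((η.pts.card.factorial : ℝ) ^ s * C ^ η.pts.card) (.of_forall fun z => ?_)
  rw [Real.norm_of_nonneg (hk0 _)]
  exact h _ _ (card_moved_le z η)

lemma GrowthBound.evolved {d : ℕ} {k : FinConf d → ℝ} (hk : GrowthBound k) (hkm : Measurable k)
    (hk0 : ∀ η, 0 ≤ k η) (ν : Measure (E d)) [IsProbabilityMeasure ν] :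
    GrowthBound (evolved ν k) := by
  obtain ⟨s, C, hs, hs1, hC, h⟩ := hk.exists_le
  refine ⟨s, C, hs, hs1, hC, fun η => ?_⟩
  have := integral_mono (integrable_moved ν hkm hk0 hk η) (integrable_const _)
    fun z => h _ _ (card_moved_le z η)
  rw [integral_const, probReal_univ, one_smul] at this
  exact this

lemma shift_img {d : ℕ} {ι : Type*} [Fintype ι] (v : E d) (x : ι → E d) :
    (img x).shift v = img fun i => x i + v := by
  ext y
  simp [FinConf.shift, mem_img]

lemma img_val {d : ℕ} (η : FinConf d) : img (fun i : η.pts => (i : E d)) = η := by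
  ext y
  simp [mem_img]

lemma TranslationInvariant.evolved {d : ℕ} {k : FinConf d → ℝ} (hk : TranslationInvariant k)
    (hkm : Measurable k) (ν : Measure (E d)) [IsProbabilityMeasure ν] :
    TranslationInvariant (evolved ν k) := by
  intro v η
  conv_lhs => rw [← img_val η, shift_img]
  conv_rhs => rw [← img_val η]
  unfold FreeKawasaki.evolved
  have hinj : Function.Injective fun i : η.pts => (i : E d) + v :=
    (add_left_injective v).comp Subtype.val_injective
  rw [integral_moved_img ν hinj hkm,
    integral_moved_img ν Subtype.val_injective hkm]
  refine integral_congr_ae (.of_forall fun z => ?_)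
  dsimp only
  conv_rhs => rw [← hk v (img _), shift_img]
  congr 2
  funext i
  simp only [Pi.add_apply]
  abel

lemma union_shift_eq_img {d : ℕ} {α β : Type*} [Fintype α] [Fintype β] (x : α → E d)
    (y : β → E d) (v : E d) :
    (img x).union ((img y).shift v) = img (Sum.elim x y + Sum.elim (0 : α → E d) fun _ => v) := by
  ext w
  simp [FinConf.union, shift_img, mem_img]

/-- Within each group nothing changes, and once ‖ε⁻¹ • v‖ exceeds all distances between the groups
no cross coincidence is possible. -/
lemma eventually_injective_sum_elim {d : ℕ} {α β : Type*} [Fintype α] [Fintype β] {x : α → E d}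
    {y : β → E d} (hxy : Function.Injective (Sum.elim x y)) {v : E d} (hv : v ≠ 0) :
    ∀ᶠ ε : ℝ in 𝓝[>] 0,
      Function.Injective (Sum.elim x y + Sum.elim (0 : α → E d) fun _ => ε⁻¹ • v) := by
  have hx : Function.Injective x := hxy.comp Sum.inl_injective
  have hy : Function.Injective y := hxy.comp Sum.inr_injective
  have h1 : Tendsto (fun ε : ℝ => ‖ε⁻¹ • v‖) (𝓝[>] 0) atTop := by
    simp_rw [norm_smul]
    exact (tendsto_norm_atTop_atTop.comp tendsto_inv_nhdsGT_zero).atTop_mul_const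
      (norm_pos_iff.2 hv)
  have h2 : ∀ᶠ ε : ℝ in 𝓝[>] 0, ∀ i j, ‖x i - y j‖ < ‖ε⁻¹ • v‖ :=
    eventually_all.2 fun i => eventually_all.2 fun j => h1.eventually_gt_atTop _
  filter_upwards [h2] with ε hε
  have hne : ∀ i j, x i ≠ y j + ε⁻¹ • v := fun i j h => by
    have := hε i j
    rw [h, add_sub_cancel_left] at this
    exact lt_irrefl _ this
  rintro (i | i) (j | j) hij
  · exact congrArg Sum.inl (hx (by simpa using hij))
  · exact absurd (by simpa using hij) (hne i j)
  · exact absurd (by simpa using hij.symm) (hne j i)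
  · exact congrArg Sum.inr (hy (by simpa using hij))

/-- The displacements have one fixed product law, so the decay of u can be applied for almost every
fixed displacement and then integrated. -/
lemma DecayOfCorrelations.evolved {d : ℕ} {k : FinConf d → ℝ} (hk : DecayOfCorrelations k)
    (hkm : Measurable k) (hk0 : ∀ η, 0 ≤ k η) (hkg : GrowthBound k) {ν : Measure (E d)}
    [IsProbabilityMeasure ν] (hν : ∀ v, v ≠ 0 → ν {v} = 0) :
    DecayOfCorrelations (evolved ν k) := by
  obtain ⟨u, hu, hdecay⟩ := hk
  refine ⟨FreeKawasaki.evolved ν u, isUrsell_evolved hu hkm hk0 hkg hν,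
    fun η ξ hη hξ hηξ v hv => ?_⟩
  have hum := hu.measurable hkm
  let x : η.pts ⊕ ξ.pts → E d := Sum.elim Subtype.val Subtype.val
  have hx : Function.Injective x :=
    Function.Injective.sumElim Subtype.val_injective Subtype.val_injective fun i j h =>
      Finset.disjoint_left.1 hηξ i.2 (h ▸ j.2)
  let s : ℝ → η.pts ⊕ ξ.pts → E d := fun ε => Sum.elim (0 : η.pts → E d) fun _ => ε⁻¹ • v
  have hset : ∀ ε : ℝ, η.union (ξ.shift (ε⁻¹ • v)) = img (x + s ε) := fun ε => by
    rw [← union_shift_eq_img, img_val, img_val]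
  have heq : ∀ᶠ ε : ℝ in 𝓝[>] 0, ∫ z, u (img (x + s ε + z)) ∂(Measure.pi fun _ => ν) =
      FreeKawasaki.evolved ν u (η.union (ξ.shift (ε⁻¹ • v))) := by
    filter_upwards [eventually_injective_sum_elim hx hv] with ε hε
    rw [hset, FreeKawasaki.evolved, integral_moved_img ν hε hum]
  refine Tendsto.congr' heq ?_
  obtain ⟨M, hM⟩ := hu.exists_abs_le_of_card_le hk0 hkg (Fintype.card (η.pts ⊕ ξ.pts))
  have hlim : Tendsto (fun ε => ∫ z, u (img (x + s ε + z)) ∂(Measure.pi fun _ => ν)) (𝓝[>] 0)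
      (𝓝 (∫ _, (0 : ℝ) ∂(Measure.pi fun _ : η.pts ⊕ ξ.pts => ν))) := by
    -- The product measure does not depend on ε, and u is uniformly bounded on configurations with
    -- at most |η| + |ξ| points, so a constant dominates.
    refine tendsto_integral_filter_of_dominated_convergence (fun _ => M) ?_ ?_
      (integrable_const M) ?_
    · exact .of_forall fun ε =>
        (hum.comp (measurable_img.comp (measurable_const_add _))).aestronglyMeasurable
    · exact .of_forall fun ε => .of_forall fun z => hM _ (card_img_le _)
    -- For almost every z the displaced points are distinct, so the two displaced groups are
    -- disjoint and the decay hypothesis applies to them.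
    · filter_upwards [ae_pi_injective hν hx] with z hz
      have h := hdecay (img fun i : η.pts => (i : E d) + z (.inl i))
        (img fun i : ξ.pts => (i : E d) + z (.inr i)) ?_ ?_ ?_ v hv
      · refine h.congr fun ε => ?_
        rw [union_shift_eq_img]
        congr 2
        funext i
        rcases i with i | i
        · simp [x, s]
        · simp only [Pi.add_apply, Sum.elim_inr, x, s]
          abel
      · obtain ⟨y, hy⟩ := hη
        exact ⟨_, mem_img.2 ⟨⟨y, hy⟩, rfl⟩⟩
      · obtain ⟨y, hy⟩ := hξ
        exact ⟨_, mem_img.2 ⟨⟨y, hy⟩, rfl⟩⟩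
      · rw [Finset.disjoint_left]
        intro w hw hw'
        obtain ⟨i, hi⟩ := mem_img.1 hw
        obtain ⟨j, hj⟩ := mem_img.1 hw'
        exact Sum.inl_ne_inr (hz (show (x + z) (.inl i) = (x + z) (.inr j) from hi.trans hj.symm))
  simpa using hlim

lemma IsAdmissible.evolved {d : ℕ} {k : FinConf d → ℝ} (hk : IsAdmissible k) (hkm : Measurable k)
    (hk0 : ∀ η, 0 ≤ k η) {ν : Measure (E d)} [IsProbabilityMeasure ν]
    (hν : ∀ v, v ≠ 0 → ν {v} = 0) : IsAdmissible (evolved ν k) where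
  growth := hk.growth.evolved hkm hk0 ν
  translation := hk.translation.evolved hkm ν
  decay := hk.decay.evolved hkm hk0 hk.growth hν

/-! ### The law of the displaced process -/

lemma isProbabilityMeasure_bind_displacedLaw {d : ℕ} {ν : Measure (E d)} [IsProbabilityMeasure ν]
    {μ : Measure (Conf d)} [IsProbabilityMeasure μ] (hμ : ∀ᵐ γ ∂μ, Dispersed ν γ) :
    IsProbabilityMeasure (μ.bind (displacedLaw ν)) := by
  constructor
  rw [Measure.bind_apply .univ (aemeasurable_displacedLaw hμ)]
  have : ∀ᵐ γ ∂μ, displacedLaw ν γ Set.univ = 1 := by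
    filter_upwards [hμ] with γ hγ
    have := hγ.isProbabilityMeasure
    exact measure_univ
  rw [lintegral_congr_ae this]
  simp

/-- The displacement passes from the configuration to the observable, then by the correlation
identity under λ, and finally by symmetry onto k. -/
lemma isCorrelationFunctional_evolved {d : ℕ} (hd : 1 ≤ d) {ν : Measure (E d)}
    [IsProbabilityMeasure ν] [ν.IsNegInvariant] (hν : ∀ v, v ≠ 0 → ν {v} = 0)
    {μ : Measure (Conf d)} (hμ : ∀ᵐ γ ∂μ, Dispersed ν γ) {k : FinConf d → ℝ}
    (hk : IsCorrelationFunctional μ k) (hkg : GrowthBound k) :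
    IsCorrelationFunctional (μ.bind (displacedLaw ν)) (evolved ν k) where
  measurable := measurable_evolved ν hk.measurable
  nonneg := evolved_nonneg ν hk.nonneg
  density := fun G hG => by
    have hof : ∀ η, ENNReal.ofReal (evolved ν k η) =
        levolved ν (fun η => ENNReal.ofReal (k η)) η := fun η =>
      ofReal_integral_eq_lintegral_ofReal (integrable_moved ν hk.measurable hk.nonneg hkg η)
        (.of_forall fun _ => hk.nonneg _)
    have hkm : Measurable fun η => ENNReal.ofReal (k η) := hk.measurable.ennreal_ofReal
    rw [Measure.lintegral_bind (aemeasurable_displacedLaw hμ)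
      (measurable_KTransform hG).aemeasurable]
    calc ∫⁻ γ, ∫⁻ γ', KTransform G γ' ∂displacedLaw ν γ ∂μ
        = ∫⁻ γ, KTransform (levolved ν G) γ ∂μ := by
          refine lintegral_congr_ae ?_
          filter_upwards [hμ] with γ hγ using hγ.lintegral_KTransform hν hG
      _ = ∫⁻ η, levolved ν G η * ENNReal.ofReal (k η) ∂lebesguePoisson d := by
          rw [hk.density _ (measurable_levolved ν hG),
            lintegral_withDensity_eq_lintegral_mul _ hkm (measurable_levolved ν hG)]
          simp_rw [Pi.mul_apply, mul_comm]
      _ = ∫⁻ η, G η * levolved ν (fun η => ENNReal.ofReal (k η)) η ∂lebesguePoisson d :=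
          lintegral_levolved_mul hd ν hG hkm
      _ = _ := by
          simp_rw [hof]
          rw [lintegral_withDensity_eq_lintegral_mul _ (measurable_levolved ν hkm) hG]
          simp_rw [Pi.mul_apply, mul_comm]

/-! ### Polynomial growth and one-time marginals. -/

lemma ncard_inter_closedBall {d : ℕ} (γ : Conf d) (r : ℝ) :
    ((γ.carrier ∩ Metric.closedBall 0 r).ncard : ℝ) = (cnt γ (Metric.closedBall 0 r)).toReal := by
  have hK := isCompact_closedBall (0 : E d) r
  rw [cnt_apply_of_isCompact γ hK, Set.ncard_eq_toFinset_card _ (γ.locallyFinite _ hK)]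
  simp

/-- Point processes with bounded intensity live on configurations of polynomial growth. -/
lemma measure_Theta {d : ℕ} {μ : Measure (Conf d)} [IsProbabilityMeasure μ] {k : FinConf d → ℝ}
    (hk : IsCorrelationFunctional μ k) {c : ℝ} (hc : ∀ x, k (FinConf.single x) = c) :
    μ (Theta d) = 1 := by
  let B : ℕ → Set (E d) := fun n => Metric.closedBall 0 ((n : ℝ) + 1)
  have hB : ∀ n, MeasurableSet (B n) := fun n => Metric.isClosed_closedBall.measurableSet
  -- The expected count in a ball of radius n + 1 is of order (n + 1)^d, so this weight leaves the
  -- summable (n + 1)^{-2}.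
  let w : ℕ → ℝ≥0∞ := fun n => ENNReal.ofReal (1 / ((n : ℝ) + 1) ^ (d + 2))
  have hmeas : ∀ n, Measurable fun γ : Conf d => cnt γ (B n) := fun n => measurable_cnt (hB n)
  let V : ℝ≥0∞ := volume (Metric.ball (0 : E d) 1)
  have hterm : ∀ n, ∫⁻ γ, cnt γ (B n) * w n ∂μ =
      ENNReal.ofReal c * V * ENNReal.ofReal (1 / ((n : ℝ) + 1) ^ 2) := fun n => by
    rw [lintegral_mul_const _ (hmeas n)]
    have h := lintegral_lintegral_cnt hk hc (measurable_one.indicator (hB n))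
    simp_rw [lintegral_indicator_one (hB n)] at h
    rw [h]
    simp only [B, w]
    rw [Measure.addHaar_closedBall _ _ (by positivity), finrank_euclideanSpace_fin]
    rw [show ENNReal.ofReal c * (ENNReal.ofReal (((n : ℝ) + 1) ^ d) * V) *
        ENNReal.ofReal (1 / ((n : ℝ) + 1) ^ (d + 2)) = ENNReal.ofReal c * V *
        (ENNReal.ofReal (((n : ℝ) + 1) ^ d) * ENNReal.ofReal (1 / ((n : ℝ) + 1) ^ (d + 2))) by ring,
      ← ENNReal.ofReal_mul (by positivity)]
    congr 2
    field_simp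
    ring
  have hfin : ∫⁻ γ, ∑' n, cnt γ (B n) * w n ∂μ ≠ ∞ := by
    rw [lintegral_tsum fun n => ((hmeas n).mul_const _).aemeasurable]
    simp_rw [hterm]
    rw [ENNReal.tsum_mul_left]
    refine ENNReal.mul_ne_top (ENNReal.mul_ne_top ENNReal.ofReal_ne_top measure_ball_lt_top.ne) ?_
    have hs : Summable fun n : ℕ => 1 / ((n : ℝ) + 1) ^ 2 := by
      have := (summable_nat_add_iff 1).2 (Real.summable_one_div_nat_pow.2 one_lt_two)
      simpa using this
    exact hs.tsum_ofReal_ne_top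
  have hae := ae_lt_top (Measurable.tsum fun n => (hmeas n).mul_const (w n)) hfin
  have hΘ : ∀ᵐ γ ∂μ, γ ∈ Theta d := by
    filter_upwards [hae] with γ hγ
    set S := ∑' n, cnt γ (B n) * w n
    -- Each weighted count is at most S, so each count is at most S times the inverse weight; the
    -- added 1 keeps the constant positive.
    refine ⟨(d : ℝ) + 2, S.toReal + 1, by linarith, by positivity, fun n hn => ?_⟩
    obtain ⟨m, rfl⟩ : ∃ m, n = m + 1 := ⟨n - 1, by omega⟩
    rw [ncard_inter_closedBall]
    have h1 : cnt γ (B m) * w m ≤ S := ENNReal.le_tsum m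
    have h2 := ENNReal.toReal_mono hγ.ne h1
    rw [ENNReal.toReal_mul, ENNReal.toReal_ofReal (by positivity), mul_one_div,
      div_le_iff₀ (by positivity)] at h2
    have h3 : ((m + 1 : ℕ) : ℝ) ^ ((d : ℝ) + 2) = ((m : ℝ) + 1) ^ (d + 2) := by
      rw [← Real.rpow_natCast]
      push_cast
      rfl
    rw [h3]
    simp only [B] at h2
    push_cast
    refine h2.trans (mul_le_mul_of_nonneg_right (by linarith) (by positivity))
  refine le_antisymm prob_le_one ?_
  -- Subadditivity of the outer measure yields full mass without requiring `Theta d` to be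
  -- measurable.
  calc (1 : ℝ≥0∞) = μ Set.univ := measure_univ.symm
    _ ≤ μ (Theta d ∪ (Theta d)ᶜ) := by rw [Set.union_compl_self]
    _ ≤ μ (Theta d) + μ (Theta d)ᶜ := measure_union_le _ _
    _ = μ (Theta d) := by rw [show μ (Theta d)ᶜ = 0 from hΘ, add_zero]

/-- The one-time marginals of a Markov process with transition function `P_t`. -/
lemma IsFreeKawasakiProcess.map_eq {d : ℕ} {a : SchwartzMap (E d) ℝ} {μ₀ : Measure (Conf d)}
    {ℙ : Measure (ℝ≥0 → Conf d)} (hℙ : IsFreeKawasakiProcess a μ₀ ℙ) {t : ℝ≥0}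
    (hm : AEMeasurable (freeTransition a t) μ₀)
    (hp : ∀ᵐ γ ∂μ₀, IsProbabilityMeasure (freeTransition a t γ))
    [IsProbabilityMeasure (freeLaw a μ₀ t)] :
    ℙ.map (fun ω => ω t) = freeLaw a μ₀ t := by
  have := hℙ.isProbabilityMeasure
  ext A hA
  have hmt : Measurable fun ω : ℝ≥0 → Conf d => ω t := measurable_pi_apply t
  have hm0 : Measurable fun ω : ℝ≥0 → Conf d => ω 0 := measurable_pi_apply 0
  have hpast : past d 0 ≤ MeasurableSpace.pi :=
    iSup_le fun r => (measurable_pi_apply (r : ℝ≥0)).comap_le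
  -- Integrating the Markov property at time 0 removes the conditioning; the initial law then turns
  -- the right side into the mixture `freeLaw`.
  have h := integral_congr_ae (hℙ.markov 0 t A hA)
  rw [integral_condExp hpast, zero_add,
    show {ω : ℝ≥0 → Conf d | ω t ∈ A} = (fun ω => ω t) ⁻¹' A from rfl,
    integral_indicator_const _ (hmt hA), smul_eq_mul,
    mul_one] at h
  have hmA : AEMeasurable (fun γ => freeTransition a t γ A) μ₀ :=
    (Measure.measurable_coe hA).comp_aemeasurable hm
  have h2 : ∫ ω, (freeTransition a t (ω 0)).real A ∂ℙ =
      ∫ γ, (freeTransition a t γ A).toReal ∂μ₀ := by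
    rw [← hℙ.initial, integral_map hm0.aemeasurable]
    · rfl
    · rw [hℙ.initial]
      exact hmA.ennreal_toReal.aestronglyMeasurable
  rw [h2, integral_toReal hmA, ← Measure.bind_apply hA hm] at h
  · rw [Measure.map_apply hmt hA]
    exact (ENNReal.toReal_eq_toReal_iff' (measure_ne_top _ _)
      (measure_ne_top (freeLaw a μ₀ t) A)).1 h
  · filter_upwards [hp] with γ hγ
    exact measure_lt_top _ _

/-! ### The free functionals -/

/-- The product of zeros is the indicator of the empty configuration, which has λ-mass one; hence g
needs no measurability. -/
lemma integral_expLambda_zero {d : ℕ} (g : FinConf d → ℝ) {f : E d → ℝ} (hf : ∀ x, f x = 0) :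
    ∫ ξ, expLambda f ξ * g ξ ∂lebesguePoisson d = g ⟨∅⟩ := by
  let s : Set (FinConf d) := {η | η.pts.card = 0}
  have hs : MeasurableSet s := measurableSet_card_eq d 0
  have hμ : lebesguePoisson d s = 1 := by
    rw [← lintegral_indicator_one hs,
      lintegral_lebesguePoisson (measurable_one.indicator hs), tsum_eq_single 0]
    · have h1 : ∀ x : Fin 0 → E d, s.indicator (1 : FinConf d → ℝ≥0∞) (tupleConf x) = 1 := by
        intro x
        refine Set.indicator_of_mem ?_ _
        simp [s, tupleConf]
      have h2 : {x : Fin 0 → E d | Function.Injective x} = Set.univ :=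
        Set.eq_univ_of_forall fun x => Function.injective_of_subsingleton x
      simp_rw [h1, h2]
      simp [volume_pi]
    · intro n hn
      rw [setLIntegral_congr_fun (measurableSet_injective d _) (g := 0) fun x hx => ?_]
      · simp
      · refine Set.indicator_of_notMem ?_ _
        simp only [s, Set.mem_ofPred_eq]
        rw [tupleConf_eq_img, card_img hx, Fintype.card_fin]
        exact hn
  have heq : (fun ξ => expLambda f ξ * g ξ) = s.indicator fun _ => g ⟨∅⟩ := by
    funext ξ
    by_cases hξ : ξ ∈ s
    · rw [Set.indicator_of_mem hξ]
      have : ξ = ⟨∅⟩ := FinConf.ext (Finset.card_eq_zero.1 hξ)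
      rw [this]
      simp [expLambda]
    · rw [Set.indicator_of_notMem hξ]
      obtain ⟨x, hx⟩ := Finset.card_ne_zero.1 hξ
      rw [expLambda, Finset.prod_eq_zero hx (hf x), zero_mul]
  rw [heq, integral_indicator_const _ hs, Measure.real, hμ]
  simp

/-- The normalisation comes from the Ursell relation: the empty set has one partition, without
blocks, and its product is empty. -/
lemma DecayOfCorrelations.empty_eq_one {d : ℕ} {k : FinConf d → ℝ} (hk : DecayOfCorrelations k) :
    k ⟨∅⟩ = 1 := by
  classical
  obtain ⟨u, hu, -⟩ := hk
  rw [hu]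
  have h : ∀ π : Finpartition (∅ : Finset (E d)), π.parts = ∅ := fun π =>
    Finpartition.parts_eq_empty_iff.2 rfl
  have huniq : Unique (Finpartition (∅ : Finset (E d))) :=
    ⟨⟨Finpartition.empty _⟩, fun π => Finpartition.ext ((h π).trans (h _).symm)⟩
  change ∑ π : Finpartition (∅ : Finset (E d)), _ = _
  rw [Fintype.sum_unique, h, Finset.prod_empty]

lemma TranslationInvariant.single_eq {d : ℕ} {k : FinConf d → ℝ} (hk : TranslationInvariant k)
    (x : E d) : k (FinConf.single x) = k (FinConf.single 0) := by
  rw [← hk x (FinConf.single 0)]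
  congr 1
  ext y
  simp [FinConf.single, FinConf.shift, eq_comm]

/-- By translation invariance the integrand is constant, so the particle density is conserved. -/
lemma evolved_single {d : ℕ} {k : FinConf d → ℝ} (hk : TranslationInvariant k)
    (ν : Measure (E d)) [IsProbabilityMeasure ν] (x : E d) :
    evolved ν k (FinConf.single x) = k (FinConf.single 0) := by
  have h : ∀ z : E d → E d, k (moved z (FinConf.single x)) = k (FinConf.single 0) := fun z => by
    rw [← hk.single_eq (x + z x)]
    congr 1
  unfold evolved
  simp_rw [h]
  simp

/-- The product of the kernels is the n-fold product of ν translated by x. For distinct entries this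
is also the joint law of the displaced points under `disp`. -/
lemma walkTensor_corrFun {d : ℕ} {a : SchwartzMap (E d) ℝ} {t : ℝ≥0}
    [IsProbabilityMeasure (walkKernel a t 0)] {k : FinConf d → ℝ} (hk : Measurable k) {n : ℕ}
    {x : Fin n → E d} (hx : Function.Injective x) :
    walkTensor a t n (corrFun k n) x = corrFun (evolved (walkKernel a t 0) k) n x := by
  have hpi : (Measure.pi fun i => walkKernel a t (x i)) =
      (Measure.pi fun _ : Fin n => walkKernel a t 0).map (x + ·) := by
    simp_rw [fun i => walkKernel_eq_map a t (x i)]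
    exact (Measure.pi_map_pi fun i => (measurable_const_add (x i)).aemeasurable).symm
  rw [walkTensor, hpi, integral_map (measurable_const_add x).aemeasurable, corrFun,
    tupleConf_eq_img, evolved, integral_moved_img _ hx hk]
  · simp_rw [corrFun, tupleConf_eq_img]
  · exact (hk.comp measurable_tupleConf).aestronglyMeasurable

lemma freeTransition_eq_displacedLaw {d : ℕ} (a : SchwartzMap (E d) ℝ) (t : ℝ≥0) :
    freeTransition a t = displacedLaw (walkKernel a t 0) := by
  funext γ
  have : (fun x : γ.carrier => walkKernel a t (x : E d)) =
      fun x : γ.carrier => (walkKernel a t 0).map ((x : E d) + ·) :=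
    funext fun x => walkKernel_eq_map a t x
  rw [freeTransition, displacedLaw, positions, this]

end

end FreeKawasaki

/-! ### Proof of the claim. -/

theorem proposition1 (d : ℕ) (hd : 1 ≤ d)
    (a : SchwartzMap (FreeKawasaki.E d) ℝ)
    (ha_nonneg : ∀ x, 0 ≤ a x) (ha_even : ∀ x, a (-x) = a x)
    (ha_int : ∫ x, a x = 1)
    (μ₀ : MeasureTheory.Measure (FreeKawasaki.Conf d))
    (hμ₀ : MeasureTheory.IsProbabilityMeasure μ₀)
    (hΘ : μ₀ (FreeKawasaki.Theta d) = 1)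
    (k₀ : FreeKawasaki.FinConf d → ℝ)
    (hk₀ : FreeKawasaki.IsCorrelationFunctional μ₀ k₀)
    (hadm : FreeKawasaki.IsAdmissible k₀) :
    -- the distribution at time `t` of the free dynamics is a well-defined probability
    -- measure concentrated on `Θ`, and is the one-time marginal of the Markov process
    (∀ t : NNReal,
      AEMeasurable (FreeKawasaki.freeTransition a t) μ₀ ∧
      MeasureTheory.IsProbabilityMeasure (FreeKawasaki.freeLaw a μ₀ t) ∧
      FreeKawasaki.freeLaw a μ₀ t (FreeKawasaki.Theta d) = 1 ∧
      ∀ P : MeasureTheory.Measure (NNReal → FreeKawasaki.Conf d),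
        FreeKawasaki.IsFreeKawasakiProcess a μ₀ P →
          P.map (fun ω => ω t) = FreeKawasaki.freeLaw a μ₀ t) ∧
    -- it has a correlation functional with the asserted properties
    ∀ t : NNReal, ∃ k : FreeKawasaki.FinConf d → ℝ,
      FreeKawasaki.IsCorrelationFunctional (FreeKawasaki.freeLaw a μ₀ t) k ∧
      (∀ (n : ℕ) (x : Fin n → FreeKawasaki.E d), Function.Injective x →
        FreeKawasaki.corrFun k n x =
          FreeKawasaki.walkTensor a t n (FreeKawasaki.corrFun k₀ n) x) ∧
      FreeKawasaki.IsAdmissible k ∧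
      FreeKawasaki.cMinus 0 k = 1 ∧
      ∀ x : FreeKawasaki.E d,
        FreeKawasaki.cPlus 0 k = k₀ (FreeKawasaki.FinConf.single x) := by
  have hν (t : NNReal) : IsProbabilityMeasure (FreeKawasaki.walkKernel a t 0) :=
    FreeKawasaki.isProbabilityMeasure_walkKernel ha_nonneg ha_even ha_int t 0
  have hneg (t : NNReal) : (FreeKawasaki.walkKernel a t 0).IsNegInvariant :=
    ⟨FreeKawasaki.walkKernel_map_neg ha_nonneg ha_even ha_int t⟩
  have hatom (t : NNReal) : ∀ v, v ≠ 0 → FreeKawasaki.walkKernel a t 0 {v} = 0 := fun v hv =>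
    FreeKawasaki.walkKernel_singleton_eq_zero a hd t hv
  have hdisp (t : NNReal) := FreeKawasaki.ae_dispersed hk₀ hadm.translation.single_eq
    (FreeKawasaki.walkKernel a t 0)
  have hcorr (t : NNReal) : FreeKawasaki.IsCorrelationFunctional (FreeKawasaki.freeLaw a μ₀ t)
      (FreeKawasaki.evolved (FreeKawasaki.walkKernel a t 0) k₀) := by
    rw [FreeKawasaki.freeLaw, FreeKawasaki.freeTransition_eq_displacedLaw]
    exact FreeKawasaki.isCorrelationFunctional_evolved hd (hatom t) (hdisp t) hk₀ hadm.growth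
  have hmeas (t : NNReal) : AEMeasurable (FreeKawasaki.freeTransition a t) μ₀ := by
    rw [FreeKawasaki.freeTransition_eq_displacedLaw]
    exact FreeKawasaki.aemeasurable_displacedLaw (hdisp t)
  have hprob (t : NNReal) : IsProbabilityMeasure (FreeKawasaki.freeLaw a μ₀ t) := by
    rw [FreeKawasaki.freeLaw, FreeKawasaki.freeTransition_eq_displacedLaw]
    exact FreeKawasaki.isProbabilityMeasure_bind_displacedLaw (hdisp t)
  -- The witness for k_t is the functional in `hcorr t`, the expectation of k₀ over displaced
  -- configurations.
  refine ⟨fun t => ⟨hmeas t, hprob t, ?_, fun P hP => ?_⟩, fun t => ⟨_, hcorr t, ?_, ?_, ?_, ?_⟩⟩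
  · exact FreeKawasaki.measure_Theta (hcorr t)
      (FreeKawasaki.evolved_single hadm.translation _)
  · refine hP.map_eq (hmeas t) ?_
    filter_upwards [hdisp t] with γ hγ
    rw [FreeKawasaki.freeTransition_eq_displacedLaw]
    exact hγ.isProbabilityMeasure
  · exact fun n x hx => (FreeKawasaki.walkTensor_corrFun hk₀.measurable hx).symm
  · exact hadm.evolved hk₀.measurable hk₀.nonneg (hatom t)
  · rw [FreeKawasaki.cMinus, FreeKawasaki.integral_expLambda_zero _ fun x => by simp]
    exact (hadm.decay.evolved hk₀.measurable hk₀.nonneg hadm.growth (hatom t)).empty_eq_one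
  · intro x
    rw [FreeKawasaki.cPlus, FreeKawasaki.integral_expLambda_zero _ fun x => by simp,
      hadm.translation.single_eq x,
      ← FreeKawasaki.evolved_single hadm.translation (FreeKawasaki.walkKernel a t 0) 0]
    -- Here ∅ ∪ {0} and {0} are identified.
    congr 1
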